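/- Let $\omega=\frac{1+\sqrt{-3}}{2}$. Call $(a,b)$ an Eisenstein pair if $a$ and $b$ are positive integers such that $a^2+ab+b^2$ is a perfect square. For $z\in\mathbb{C}$ with $|z|=1$, let $\ell(z)=\{tz : t\ge 0\}$ be the half-line which begins at $0$ and passes through $z$, let $\delta'(z,(a,b))$ be the Euclidean distance from $a+b\omega$ to $\ell(z)$, and let $$\delta(z)=\liminf_{(a,b)}\ \delta'(z,(a,b))\in[0,\infty],$$ where $(a,b)$ runs over the Eisenstein pairs, ordered by the absolute value $|a+b\omega|=\sqrt{a^2+ab+b^2}$. Then the greatest accumulation point in $\mathbb{R}$ of the set $$\{\delta(z) : z\in\mathbb{C},\ |z|=1,\ \delta(z)<\infty\}$$ is $\dfrac{\sqrt3}{4}$. -/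

import Mathlib

open Filter Topology

noncomputable section

/-- `ω = (1 + √-3) / 2`. -/
def eisensteinOmega : ℂ := (1 + (Real.sqrt 3 : ℂ) * Complex.I) / 2

/-- An Eisenstein pair: positive integers `a`, `b` such that `a² + ab + b²` is a perfect square. -/
def IsEisensteinPair (p : ℕ × ℕ) : Prop :=
  0 < p.1 ∧ 0 < p.2 ∧ IsSquare (p.1 ^ 2 + p.1 * p.2 + p.2 ^ 2)

/-- The point `a + bω` of the complex plane associated to the pair `(a, b)`. -/
def eisensteinPoint (p : ℕ × ℕ) : ℂ := (p.1 : ℂ) + (p.2 : ℂ) * eisensteinOmega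

/-- The half-line `ℓ(z)` which begins at `0` and passes through `z` (meant for `z ≠ 0`). -/
def halfLine (z : ℂ) : Set ℂ := {w | ∃ t : ℝ, 0 ≤ t ∧ w = (t : ℂ) * z}

/-- The shortest Euclidean distance `δ'(z, (a, b))` from `a + bω` to the half-line `ℓ(z)`. -/
def rayDist (z : ℂ) (p : ℕ × ℕ) : ENNReal := Metric.infEDist (eisensteinPoint p) (halfLine z)

/-- `δ(z) = liminf δ'(z, (a, b))`, a number in `[0, ∞]`, where `(a, b)` runs over the Eisenstein
pairs ordered by the absolute value `|a + bω|`. -/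
def eisensteinDelta (z : ℂ) : ENNReal :=
  liminf (fun p : {p : ℕ × ℕ // IsEisensteinPair p} => rayDist z p.1)
    (comap (fun p : {p : ℕ × ℕ // IsEisensteinPair p} => ‖eisensteinPoint p.1‖) atTop)

/-- The set of real numbers `{δ(z) : |z| = 1, δ(z) < ∞}`. -/
def eisensteinDeltaSet : Set ℝ :=
  {x | ∃ z : ℂ, ‖z‖ = 1 ∧ eisensteinDelta z < ⊤ ∧ x = (eisensteinDelta z).toReal}

end

/-! Solving a² + ab + b² = c² rationally shows that every Eisenstein pair is a multiple of a value
of one of two pairs of binary quadratic forms in (p, q). For the direction with parameter `t`, the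
distance to the ray is √3 times an indefinite form of discriminant one whose first root is `t` for
one family and `3 t` for the other. Hence δ equals `lagrValue t`, a Lagrange constant for
simultaneous approximation of `t` and `3 t` (`eisensteinDelta_eisensteinDir`). It is invariant under
`t + 1`, `-t` and `1 / (3 t)`.

To compute it, a state `(t, v)` records the form with roots `t` and `-1/(3v)`, seen on two lattices;
`t` is the future of a coding and `v` its past. Each move of the coding enlarges lattice points, so
finitely many exceptional points can be removed (`exists_goodFrom_zero_of_lt`): a constant above
√3/4 is witnessed by a state with all values at least 1/4. Evaluating at (1, 0) and (0, 1) then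
leaves, up to the mirror symmetry, only the moves `theta` and `straight`. Two consecutive `straight`
moves force `straight` for ever, and a coding without `straight` is the fixed point of `theta`.
Otherwise isolated `straight` moves separate blocks of `theta` moves. In the coordinate linearizing
`theta`, the conditions at a `straight` move compare powers of a small negative multiplier, so that
adjacent blocks have the same even length (`even_and_eq_of_mul_pow_le`). Since the moves contract,
the coding is periodic, with one state per length k.

The periodic coding of length k has value √3 / `turnHeight w` (`lagrValue_fixed`), where `w` is the
fixed point of `theta^[k] ∘ straight`. These values tend to √3/4 and, for even k, exceed it. So √3/4
is an accumulation point, and above any larger bound only finitely many values remain. -/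

/-! ### Lagrange constants of the pair `t`, `3 t` -/

/-- Every real `q * |p - τ q|` with `q` large is at least `c`. -/
def Lagr (τ c : ℝ) : Prop :=
  ∃ K : ℕ, ∀ q : ℕ, K ≤ q → ∀ p : ℤ, c ≤ q * |(p : ℝ) - τ * q|

/-- The same for `t` and `3 t` simultaneously. -/
def LagrPair (t c : ℝ) : Prop := Lagr t c ∧ Lagr (3 * t) c

/-- The best constant in `LagrPair`, in the normalization of `eisensteinDelta`. -/
noncomputable def lagrValue (t : ℝ) : ENNReal :=
  ⨆ c : {c : ℝ // LagrPair t c}, ENNReal.ofReal (Real.sqrt 3 * c.1)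

lemma Lagr.mono {τ c c' : ℝ} (h : Lagr τ c) (hc : c' ≤ c) : Lagr τ c' := by
  obtain ⟨K, hK⟩ := h
  exact ⟨K, fun q hq p => hc.trans (hK q hq p)⟩

lemma LagrPair.mono {t c c' : ℝ} (h : LagrPair t c) (hc : c' ≤ c) : LagrPair t c' :=
  ⟨h.1.mono hc, h.2.mono hc⟩

lemma sqrt_three_pos : 0 < Real.sqrt 3 := Real.sqrt_pos.2 (by norm_num)

/-- Comparisons of Lagrange constants hold only up to an arbitrarily small loss; this absorbs the
loss when passing to the supremum. -/
lemma ofReal_sqrt_mul_le_of_forall {c : ℝ} {X : ENNReal}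
    (h : ∀ c', 0 < c' → c' < c → ENNReal.ofReal (Real.sqrt 3 * c') ≤ X) :
    ENNReal.ofReal (Real.sqrt 3 * c) ≤ X := by
  refine le_of_forall_lt fun x hx => ?_
  by_contra hX
  push Not at hX
  obtain ⟨y, hxy, hy⟩ := exists_between hx
  have hyt : y ≠ ⊤ := (hy.trans_le le_top).ne
  have hy0 : 0 < y.toReal := ENNReal.toReal_pos (bot_le.trans_lt hxy).ne' hyt
  have h3 := sqrt_three_pos
  have hyc : y.toReal / Real.sqrt 3 < c := by
    rw [div_lt_iff₀ h3]
    have := (ENNReal.lt_ofReal_iff_toReal_lt hyt).1 hy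
    linarith
  have := h _ (div_pos hy0 h3) hyc
  rw [mul_div_cancel₀ _ h3.ne', ENNReal.ofReal_toReal hyt] at this
  exact absurd (this.trans hX) (not_le.2 hxy)

lemma ofReal_le_lagrValue {t c : ℝ} (h : LagrPair t c) :
    ENNReal.ofReal (Real.sqrt 3 * c) ≤ lagrValue t :=
  le_iSup (fun c : {c : ℝ // LagrPair t c} => ENNReal.ofReal (Real.sqrt 3 * c.1)) ⟨c, h⟩

lemma lagrValue_le {t : ℝ} {X : ENNReal}
    (h : ∀ c c', 0 < c' → c' < c → LagrPair t c → ENNReal.ofReal (Real.sqrt 3 * c') ≤ X) :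
    lagrValue t ≤ X :=
  iSup_le fun c => ofReal_sqrt_mul_le_of_forall fun c' h0 hc => h c.1 c' h0 hc c.2

lemma lagrValue_le_lagrValue {t t' : ℝ}
    (h : ∀ c c', 0 < c' → c' < c → LagrPair t c → LagrPair t' c') :
    lagrValue t ≤ lagrValue t' :=
  lagrValue_le fun c c' h0 hc hp => ofReal_le_lagrValue (h c c' h0 hc hp)

lemma exists_lagrPair_of_lt_lagrValue {t x : ℝ} (h : ENNReal.ofReal (Real.sqrt 3 * x) < lagrValue t) :
    ∃ c, x < c ∧ LagrPair t c := by
  obtain ⟨⟨c, hc⟩, hx⟩ := lt_iSup_iff.1 h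
  refine ⟨c, ?_, hc⟩
  by_contra hcx
  exact absurd hx (not_lt.2 (ENNReal.ofReal_le_ofReal
    (mul_le_mul_of_nonneg_left (not_lt.1 hcx) sqrt_three_pos.le)))

/-! ### Symmetries of the Lagrange constant -/

lemma Lagr.neg {τ c : ℝ} (h : Lagr τ c) : Lagr (-τ) c := by
  obtain ⟨K, hK⟩ := h
  refine ⟨K, fun q hq p => ?_⟩
  have := hK q hq (-p)
  rw [← abs_neg] at this
  push_cast at this
  convert this using 3
  ring

lemma Lagr.add_int {τ c : ℝ} (h : Lagr τ c) (n : ℤ) : Lagr (τ + n) c := by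
  obtain ⟨K, hK⟩ := h
  refine ⟨K, fun q hq p => ?_⟩
  have := hK q hq (p - n * q)
  push_cast at this
  convert this using 3
  ring

/-- Good approximations p/q of 1/τ are the inverses of good approximations q/p of τ, and p |q - τ p|
differs from q |p - q/τ| by τ |p - q/τ|², up to sign. This tends to 0 along approximations with
bounded q |p - q/τ|, whence the loss from `c` to `c'`. -/
lemma Lagr.inv {τ c c' : ℝ} (hτ : 0 < τ) (h0 : 0 < c') (hc : c' < c) (h : Lagr τ c) :
    Lagr (1 / τ) c' := by
  obtain ⟨K, hK⟩ := h
  obtain ⟨N, hN⟩ := exists_nat_gt (τ * (K + c' + 1) + τ * c' * c' / (c - c') + 1)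
  refine ⟨N, fun q hq p => ?_⟩
  by_contra hlt
  push Not at hlt
  have hqN : (N : ℝ) ≤ q := by exact_mod_cast hq
  have hd : 0 < c - c' := sub_pos.2 hc
  have e0 : 0 ≤ τ * c' * c' / (c - c') := by positivity
  have e1 : 0 ≤ τ * (K + c' + 1) := by positivity
  have hq1 : (1 : ℝ) < q := by linarith
  have hq0 : (0 : ℝ) < q := by linarith
  set x := (p : ℝ) - 1 / τ * q with hx
  have hx1 : |x| < c' := by
    have : |x| ≤ q * |x| := le_mul_of_one_le_left (abs_nonneg _) hq1.le
    linarith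
  have hqt : (K : ℝ) + c' + 1 < 1 / τ * q := by
    rw [one_div, inv_mul_eq_div, lt_div_iff₀ hτ]
    linarith
  have hpK : (K : ℝ) < p := by
    have := (abs_lt.1 hx1).1
    have hp : (p : ℝ) = x + 1 / τ * q := by rw [hx]; ring
    linarith
  have hp0 : 0 ≤ p := by
    have : (0 : ℝ) ≤ p := (Nat.cast_nonneg K).trans hpK.le
    exact_mod_cast this
  lift p to ℕ using hp0
  have hKp : K ≤ p := by
    have : (K : ℝ) ≤ p := by simpa using hpK.le
    exact_mod_cast this
  have key := hK p hKp (q : ℤ)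
  have e2 : ((q : ℤ) : ℝ) - τ * p = -(τ * x) := by
    rw [hx]; push_cast; field_simp; ring
  rw [e2, abs_neg, abs_mul, abs_of_pos hτ] at key
  have hp : (p : ℝ) = x + 1 / τ * q := by rw [hx]; push_cast; ring
  have e3 : (p : ℝ) * (τ * |x|) ≤ q * |x| + τ * |x| * |x| := by
    rw [hp]
    have : (x + 1 / τ * q) * (τ * |x|) = q * |x| + τ * |x| * x := by field_simp; ring
    rw [this]
    have := mul_le_mul_of_nonneg_left (le_abs_self x) (mul_nonneg hτ.le (abs_nonneg x))
    linarith
  have e4 : τ * c' * c' / (c - c') < q := by linarith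
  rw [div_lt_iff₀ hd] at e4
  have e5 : q * (τ * |x| * |x|) ≤ τ * c' * c' := by
    calc q * (τ * |x| * |x|) = τ * ((q * |x|) * |x|) := by ring
      _ ≤ τ * (c' * c') := by
        apply mul_le_mul_of_nonneg_left _ hτ.le
        exact mul_le_mul hlt.le hx1.le (abs_nonneg _) h0.le
      _ = _ := by ring
  have e6 : τ * |x| * |x| < c - c' := by
    by_contra hcon
    push Not at hcon
    have := mul_le_mul_of_nonneg_left hcon hq0.le
    linarith
  linarith

lemma lagrValue_neg (t : ℝ) : lagrValue (-t) = lagrValue t := by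
  have key : ∀ t, lagrValue t ≤ lagrValue (-t) := fun t =>
    lagrValue_le_lagrValue fun c c' _ hc hp =>
      LagrPair.mono ⟨hp.1.neg, by rw [mul_neg]; exact hp.2.neg⟩ hc.le
  exact le_antisymm ((key (-t)).trans_eq (by rw [neg_neg])) (key t)

lemma lagrValue_add_one (t : ℝ) : lagrValue (t + 1) = lagrValue t := by
  have key : ∀ t (n : ℤ), lagrValue t ≤ lagrValue (t + n) := fun t n =>
    lagrValue_le_lagrValue fun c c' _ hc hp =>
      LagrPair.mono ⟨hp.1.add_int n, by
        have := hp.2.add_int (3 * n)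
        push_cast at this
        rwa [mul_add]⟩ hc.le
  refine le_antisymm ((key (t + 1) (-1)).trans_eq ?_) ((key t 1).trans_eq ?_) <;> push_cast <;> ring_nf

/-- Inversion exchanges the two members of the pair: 1/(3t) comes from 3t, and 3 · 1/(3t) = 1/t from
t. -/
lemma lagrValue_mirror {t : ℝ} (ht : 0 < t) : lagrValue (1 / (3 * t)) = lagrValue t := by
  have key : ∀ t, 0 < t → lagrValue t ≤ lagrValue (1 / (3 * t)) := fun t ht =>
    lagrValue_le_lagrValue fun c c' h0 hc hp =>
      ⟨hp.2.inv (by positivity) h0 hc, by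
        have := hp.1.inv ht h0 hc
        convert this using 1
        field_simp⟩
  refine le_antisymm ((key _ (by positivity)).trans_eq ?_) (key t ht)
  congr 1
  field_simp

/-- The generator of the coding that turns by two sides of the hexagon, followed by a reflection. -/
noncomputable def theta (x : ℝ) : ℝ := (2 * x + 1) / (3 * x + 1)

/-- The generator of the coding that goes straight on. -/
noncomputable def straight (x : ℝ) : ℝ := (2 * x + 1) / (3 * x + 2)

/-- Both generators are words in translation by 1, negation and the mirror `1 / (3 x)`. -/
lemma lagrValue_theta {x : ℝ} (hx : 0 < x) : lagrValue (theta x) = lagrValue x := by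
  have e : theta x = -(1 / (3 * (1 / (3 * x) + 1))) + 1 := by
    unfold theta; field_simp; ring
  rw [e, lagrValue_add_one, lagrValue_neg, lagrValue_mirror (by positivity), lagrValue_add_one,
    lagrValue_mirror hx]

lemma lagrValue_straight {x : ℝ} (hx : 0 < x) : lagrValue (straight x) = lagrValue x := by
  have e : straight x = -(1 / (3 * ((3 * x + 2) / (3 * x + 3)))) + 1 := by
    unfold straight; field_simp; ring
  have e' : (3 * x + 2) / (3 * x + 3) = -(1 / (3 * (x + 1))) + 1 := by
    field_simp; ring
  rw [e, lagrValue_add_one, lagrValue_neg, lagrValue_mirror (by positivity), e', lagrValue_add_one,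
    lagrValue_neg, lagrValue_mirror (by positivity), lagrValue_add_one]

/-! ### Indefinite forms on two lattices and the moves of the coding -/

/-- The absolute value at `(p, q)` of the indefinite form with roots `τ` and `-1/ν`, normalized to
discriminant one. -/
noncomputable def formVal (τ ν : ℝ) (p q : ℕ) : ℝ := |(p : ℝ) - τ * q| * (ν * p + q) / (τ * ν + 1)

/-- A unimodular substitution carries a form of discriminant one to another: the first root moves by
the matrix, while the parameter of the second root moves by the transposed matrix in the opposite
direction. -/
lemma formVal_mobius {a b c d : ℕ} (hdet : |(a * d - b * c : ℝ)| = 1) {τ ν : ℝ}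
    (h1 : 0 < c * τ + d) (h2 : 0 < d + b * ν) (p q : ℕ) :
    formVal ((a * τ + b) / (c * τ + d)) ν (a * p + b * q) (c * p + d * q) =
      formVal τ ((c + a * ν) / (d + b * ν)) p q := by
  unfold formVal
  push_cast
  have e1 : (a * p + b * q : ℝ) - (a * τ + b) / (c * τ + d) * (c * p + d * q)
      = (a * d - b * c) * (p - τ * q) / (c * τ + d) := by
    obtain ⟨D, hD⟩ : ∃ D, D = c * τ + d := ⟨_, rfl⟩
    rw [← hD] at h1 ⊢
    field_simp
    rw [hD]; ring
  have e2 : (c + a * ν) / (d + b * ν) * p + q = (ν * (a * p + b * q) + (c * p + d * q)) / (d + b * ν) := by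
    obtain ⟨D, hD⟩ : ∃ D, D = d + b * ν := ⟨_, rfl⟩
    rw [← hD] at h2 ⊢
    field_simp
    rw [hD]; ring
  have e3 : (a * τ + b) / (c * τ + d) * ν + 1
      = (τ * ((c + a * ν) / (d + b * ν)) + 1) * (d + b * ν) / (c * τ + d) := by
    obtain ⟨D, hD⟩ : ∃ D, D = c * τ + d := ⟨_, rfl⟩
    obtain ⟨E, hE⟩ : ∃ E, E = d + b * ν := ⟨_, rfl⟩
    rw [← hD] at h1 ⊢
    rw [← hE] at h2 ⊢
    field_simp
    rw [hD, hE]; ring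
  rw [e1, e2, e3, abs_div, abs_mul, hdet, abs_of_pos h1, one_mul]
  obtain ⟨D, hD⟩ : ∃ D, D = c * τ + d := ⟨_, rfl⟩
  obtain ⟨E, hE⟩ : ∃ E, E = d + b * ν := ⟨_, rfl⟩
  obtain ⟨G, hG⟩ : ∃ G, G = τ * ((c + a * ν) / E) + 1 := ⟨_, rfl⟩
  rw [← hD] at h1 ⊢
  rw [← hE] at h2 ⊢
  rw [← hG]
  by_cases h : G = 0
  · rw [h]; simp
  · field_simp

/-- The form has value at least `c` at `(p, q)`, on both lattices. -/
def IsLow (t v c : ℝ) (p q : ℕ) : Prop :=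
  c ≤ formVal t (3 * v) p q ∧ c ≤ formVal (3 * t) v p q

/-- All lattice points of size at least `K` in the positive quadrant have value at least `c`. -/
def GoodFrom (t v c : ℝ) (K : ℕ) : Prop :=
  ∀ p q : ℕ, 0 < p + q → K ≤ p + q → IsLow t v c p q

/-- A variant of `GoodFrom` that asks less of the multiples of `(1, 0)`. -/
def GoodFromAux (t v c : ℝ) (K : ℕ) : Prop :=
  ∀ p q : ℕ, 0 < p + q → (K + 1 ≤ p + q ∨ 0 < q ∧ K ≤ p + q) → IsLow t v c p q

lemma GoodFrom.mono {t v c : ℝ} {K K' : ℕ} (h : GoodFrom t v c K) (hK : K ≤ K') :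
    GoodFrom t v c K' := fun p q h0 hpq => h p q h0 (hK.trans hpq)

lemma theta_pos {x : ℝ} (hx : 0 < x) : 0 < theta x := by unfold theta; positivity

lemma straight_pos {x : ℝ} (hx : 0 < x) : 0 < straight x := by unfold straight; positivity

/-- One move acts on the two lattices by the matrices (2 1; 3 1) and (2 3; 1 1), which are conjugate
under scaling t by 3. The move is taken off the future `t` and put onto the past `v`. -/
lemma isLow_theta {t v c : ℝ} (ht : 0 < t) (hv : 0 < v) {p q : ℕ}
    (h1 : IsLow (theta t) v c (2 * p + 1 * q) (3 * p + 1 * q))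
    (h2 : IsLow (theta t) v c (2 * p + 3 * q) (1 * p + 1 * q)) : IsLow t (theta v) c p q := by
  have e1 := formVal_mobius (a := 2) (b := 1) (c := 3) (d := 1) (τ := t) (ν := 3 * v)
    (by norm_num) (by push_cast; positivity) (by push_cast; positivity) p q
  have e2 := formVal_mobius (a := 2) (b := 3) (c := 1) (d := 1) (τ := 3 * t) (ν := v)
    (by norm_num) (by push_cast; positivity) (by push_cast; positivity) p q
  push_cast at e1 e2
  have f1 : (2 * t + 1) / (3 * t + 1) = theta t := rfl
  have f2 : (3 + 2 * (3 * v)) / (1 + 1 * (3 * v)) = 3 * theta v := by unfold theta; field_simp; ring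
  have f3 : (2 * (3 * t) + 3) / (1 * (3 * t) + 1) = 3 * theta t := by unfold theta; field_simp
  have f4 : (1 + 2 * v) / (1 + 3 * v) = theta v := by unfold theta; congr 1 <;> ring
  rw [f1, f2] at e1
  rw [f3, f4] at e2
  exact ⟨e1 ▸ h1.1, e2 ▸ h2.2⟩

lemma isLow_straight {t v c : ℝ} (ht : 0 < t) (hv : 0 < v) {p q : ℕ}
    (h1 : IsLow (straight t) v c (2 * p + 1 * q) (3 * p + 2 * q))
    (h2 : IsLow (straight t) v c (2 * p + 3 * q) (1 * p + 2 * q)) : IsLow t (straight v) c p q := by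
  have e1 := formVal_mobius (a := 2) (b := 1) (c := 3) (d := 2) (τ := t) (ν := 3 * v)
    (by norm_num) (by push_cast; positivity) (by push_cast; positivity) p q
  have e2 := formVal_mobius (a := 2) (b := 3) (c := 1) (d := 2) (τ := 3 * t) (ν := v)
    (by norm_num) (by push_cast; positivity) (by push_cast; positivity) p q
  push_cast at e1 e2
  have f1 : (2 * t + 1) / (3 * t + 2) = straight t := rfl
  have f2 : (3 + 2 * (3 * v)) / (2 + 1 * (3 * v)) = 3 * straight v := by
    unfold straight; field_simp; ring
  have f3 : (2 * (3 * t) + 3) / (1 * (3 * t) + 2) = 3 * straight t := by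
    unfold straight; field_simp
  have f4 : (1 + 2 * v) / (2 + 3 * v) = straight v := by unfold straight; congr 1 <;> ring
  rw [f1, f2] at e1
  rw [f3, f4] at e2
  exact ⟨e1 ▸ h1.1, e2 ▸ h2.2⟩

lemma isLow_add_one {t v c : ℝ} (ht : 0 < t) (hv : 0 < v) {p q : ℕ}
    (h1 : IsLow (t + 1) v c (1 * p + 1 * q) (0 * p + 1 * q))
    (h2 : IsLow (t + 1) v c (1 * p + 3 * q) (0 * p + 1 * q)) : IsLow t (v / (1 + 3 * v)) c p q := by
  have e1 := formVal_mobius (a := 1) (b := 1) (c := 0) (d := 1) (τ := t) (ν := 3 * v)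
    (by norm_num) (by push_cast; positivity) (by push_cast; positivity) p q
  have e2 := formVal_mobius (a := 1) (b := 3) (c := 0) (d := 1) (τ := 3 * t) (ν := v)
    (by norm_num) (by push_cast; positivity) (by push_cast; positivity) p q
  push_cast at e1 e2
  have f1 : (1 * t + 1) / (0 * t + 1) = t + 1 := by field_simp; ring
  have f2 : (0 + 1 * (3 * v)) / (1 + 1 * (3 * v)) = 3 * (v / (1 + 3 * v)) := by field_simp; ring
  have f3 : (1 * (3 * t) + 3) / (0 * (3 * t) + 1) = 3 * (t + 1) := by field_simp; ring
  have f4 : (0 + 1 * v) / (1 + 3 * v) = v / (1 + 3 * v) := by ring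
  rw [f1, f2] at e1
  rw [f3, f4] at e2
  exact ⟨e1 ▸ h1.1, e2 ▸ h2.2⟩

lemma isLow_inv_add {t v c : ℝ} (ht : 0 < t) (hv : 0 < v) {p q : ℕ}
    (h1 : IsLow (t / (3 * t + 1)) v c (1 * p + 0 * q) (3 * p + 1 * q))
    (h2 : IsLow (t / (3 * t + 1)) v c (1 * p + 0 * q) (1 * p + 1 * q)) : IsLow t (v + 1) c p q := by
  have e1 := formVal_mobius (a := 1) (b := 0) (c := 3) (d := 1) (τ := t) (ν := 3 * v)
    (by norm_num) (by push_cast; positivity) (by push_cast; positivity) p q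
  have e2 := formVal_mobius (a := 1) (b := 0) (c := 1) (d := 1) (τ := 3 * t) (ν := v)
    (by norm_num) (by push_cast; positivity) (by push_cast; positivity) p q
  push_cast at e1 e2
  have f1 : (1 * t + 0) / (3 * t + 1) = t / (3 * t + 1) := by ring
  have f2 : (3 + 1 * (3 * v)) / (1 + 0 * (3 * v)) = 3 * (v + 1) := by field_simp; ring
  have f3 : (1 * (3 * t) + 0) / (1 * (3 * t) + 1) = 3 * (t / (3 * t + 1)) := by field_simp; ring
  have f4 : (1 + 1 * v) / (1 + 0 * v) = v + 1 := by field_simp; ring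
  rw [f1, f2] at e1
  rw [f3, f4] at e2
  exact ⟨e1 ▸ h1.1, e2 ▸ h2.2⟩

lemma formVal_mirror {τ ν : ℝ} (hτ : 0 < τ) (hν : 0 < ν) (p q : ℕ) :
    formVal (1 / τ) (1 / ν) q p = formVal τ ν p q := by
  unfold formVal
  have e : (q : ℝ) - 1 / τ * p = -(p - τ * q) / τ := by field_simp; ring
  rw [e, abs_div, abs_neg, abs_of_pos hτ]
  field_simp
  ring

lemma isLow_mirror {t v c : ℝ} (ht : 0 < t) (hv : 0 < v) {p q : ℕ} (h : IsLow t v c p q) :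
    IsLow (1 / (3 * t)) (1 / (3 * v)) c q p := by
  constructor
  · have := formVal_mirror (τ := 3 * t) (ν := v) (by positivity) hv p q
    rw [show 3 * (1 / (3 * v)) = 1 / v by field_simp, this]
    exact h.2
  · have := formVal_mirror (τ := t) (ν := 3 * v) ht (by positivity) p q
    rw [show 3 * (1 / (3 * t)) = 1 / t by field_simp, this]
    exact h.1

lemma GoodFrom.mirror {t v c : ℝ} {K : ℕ} (ht : 0 < t) (hv : 0 < v) (h : GoodFrom t v c K) :
    GoodFrom (1 / (3 * t)) (1 / (3 * v)) c K := fun p q h0 hpq =>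
  isLow_mirror ht hv (h q p (by omega) (by omega))

/-- Both matrices strictly increase p + q, so the bound on the size of exceptional points drops by
one. -/
lemma GoodFrom.theta {t v c : ℝ} {K : ℕ} (ht : 0 < t) (hv : 0 < v) (h : GoodFrom (theta t) v c K) :
    GoodFrom t (theta v) c (K - 1) := fun p q h0 hpq =>
  isLow_theta ht hv (h _ _ (by omega) (by omega)) (h _ _ (by omega) (by omega))

lemma GoodFrom.straight {t v c : ℝ} {K : ℕ} (ht : 0 < t) (hv : 0 < v)
    (h : GoodFrom (straight t) v c K) : GoodFrom t (straight v) c (K - 1) := fun p q h0 hpq =>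
  isLow_straight ht hv (h _ _ (by omega) (by omega)) (h _ _ (by omega) (by omega))

lemma GoodFrom.add_one {t v c : ℝ} {K : ℕ} (ht : 0 < t) (hv : 0 < v)
    (h : GoodFrom (t + 1) v c K) : GoodFrom t (v / (1 + 3 * v)) c K := fun p q h0 hpq =>
  isLow_add_one ht hv (h _ _ (by omega) (by omega)) (h _ _ (by omega) (by omega))

/-- Translation fixes the multiples of (1, 0) and enlarges all other points of the quadrant; this is
the reason for the weaker `GoodFromAux`. -/
lemma GoodFrom.aux_of_add_one {t v c : ℝ} {K : ℕ} (ht : 0 < t) (hv : 0 < v)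
    (h : GoodFrom (t + 1) v c (K + 1)) : GoodFromAux t (v / (1 + 3 * v)) c K := fun p q h0 hpq =>
  isLow_add_one ht hv (h _ _ (by omega) (by omega)) (h _ _ (by omega) (by omega))

lemma GoodFromAux.add_one {t v c : ℝ} {K : ℕ} (ht : 0 < t) (hv : 0 < v)
    (h : GoodFromAux (t + 1) v c K) : GoodFromAux t (v / (1 + 3 * v)) c K := fun p q h0 hpq =>
  isLow_add_one ht hv (h _ _ (by omega) (by omega)) (h _ _ (by omega) (by omega))

/-- The mirrored translation enlarges the multiples of (1, 0) and keeps the second coordinate of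
every nonzero point positive, so it removes the defect left by translations. -/
lemma GoodFromAux.inv_add {t v c : ℝ} {K : ℕ} (ht : 0 < t) (hv : 0 < v)
    (h : GoodFromAux (t / (3 * t + 1)) v c K) : GoodFrom t (v + 1) c K := fun p q h0 hpq =>
  isLow_inv_add ht hv (h _ _ (by omega) (by omega)) (h _ _ (by omega) (by omega))

lemma GoodFromAux.goodFrom {t v c : ℝ} {K : ℕ} (h : GoodFromAux t v c K) :
    GoodFrom t v c (K + 1) := fun p q h0 hpq => h p q h0 (Or.inl hpq)

/-! ### Removing the exceptional lattice points -/

/-- The inverse of `theta`. -/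
lemma exists_eq_theta {t : ℝ} (h1 : 2 / 3 < t) (h2 : t < 1) : ∃ x, 0 < x ∧ t = theta x := by
  refine ⟨(1 - t) / (3 * t - 2), div_pos (by linarith) (by linarith), ?_⟩
  unfold theta
  rw [eq_div_iff]
  · obtain ⟨D, hD⟩ : ∃ D, D = 3 * t - 2 := ⟨_, rfl⟩
    have : D ≠ 0 := by linarith
    rw [← hD]
    field_simp
    rw [hD]; ring
  · have : 0 < (1 - t) / (3 * t - 2) := div_pos (by linarith) (by linarith)
    positivity

/-- The inverse of `straight`. -/
lemma exists_eq_straight {t : ℝ} (h1 : 1 / 2 < t) (h2 : t < 2 / 3) :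
    ∃ x, 0 < x ∧ t = straight x := by
  refine ⟨(2 * t - 1) / (2 - 3 * t), div_pos (by linarith) (by linarith), ?_⟩
  unfold straight
  rw [eq_div_iff]
  · obtain ⟨D, hD⟩ : ∃ D, D = 2 - 3 * t := ⟨_, rfl⟩
    have : D ≠ 0 := by linarith
    rw [← hD]
    field_simp
    rw [hD]; ring
  · have : 0 < (2 * t - 1) / (2 - 3 * t) := div_pos (by linarith) (by linarith)
    positivity

lemma irrational_of_theta {t : ℝ} (h : Irrational (theta t)) : Irrational t := by
  rintro ⟨r, rfl⟩
  exact h ⟨(2 * r + 1) / (3 * r + 1), by unfold theta; push_cast; rfl⟩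

lemma irrational_of_straight {t : ℝ} (h : Irrational (straight t)) : Irrational t := by
  rintro ⟨r, rfl⟩
  exact h ⟨(2 * r + 1) / (3 * r + 2), by unfold straight; push_cast; rfl⟩

lemma irrational_mirror {t : ℝ} (h : Irrational t) : Irrational (1 / (3 * t)) := by
  rintro ⟨r, hr⟩
  by_cases h0 : t = 0
  · exact h ⟨0, by simp [h0]⟩
  refine h ⟨1 / (3 * r), ?_⟩
  push_cast
  rw [hr]
  field_simp

lemma Irrational.ne_ratCast {t : ℝ} (h : Irrational t) (r : ℚ) : t ≠ r := fun e => h ⟨r, e.symm⟩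

/-- From a state in the middle range one can move on to a state with fewer exceptions. -/
lemma GoodFrom.exists_of_mem_Ioo {t v c : ℝ} {K : ℕ} (hi : Irrational t) (h1 : 1 / 3 < t)
    (h2 : t < 1) (hv : 0 < v) (h : GoodFrom t v c (K + 1)) :
    ∃ t' v', 0 < t' ∧ 0 < v' ∧ Irrational t' ∧ lagrValue t' = lagrValue t ∧ GoodFrom t' v' c K := by
  have big : ∀ t v : ℝ, Irrational t → 2 / 3 < t → t < 1 → 0 < v → GoodFrom t v c (K + 1) →
      ∃ t' v', 0 < t' ∧ 0 < v' ∧ Irrational t' ∧ lagrValue t' = lagrValue t ∧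
        GoodFrom t' v' c K := by
    intro t v hi h1 h2 hv h
    obtain ⟨x, hx, rfl⟩ := exists_eq_theta h1 h2
    exact ⟨x, _, hx, theta_pos hv, irrational_of_theta hi, (lagrValue_theta hx).symm,
      h.theta hx hv⟩
  have h23 := hi.ne_ratCast (2 / 3)
  have h12 := hi.ne_ratCast (1 / 2)
  push_cast at h23 h12
  rcases lt_or_gt_of_ne h23 with h3 | h3
  · rcases lt_or_gt_of_ne h12 with h4 | h4
    -- The mirror carries (1/3, 1/2) onto (2/3, 1).
    · have ht : 0 < t := by linarith
      obtain ⟨t', v', a, b, i, e, g⟩ := big (1 / (3 * t)) (1 / (3 * v)) (irrational_mirror hi)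
        (by rw [lt_div_iff₀ (by positivity)]; linarith)
        (by rw [div_lt_iff₀ (by positivity)]; linarith) (by positivity) (h.mirror ht hv)
      exact ⟨t', v', a, b, i, e.trans (lagrValue_mirror ht), g⟩
    · obtain ⟨x, hx, rfl⟩ := exists_eq_straight h4 h3
      exact ⟨x, _, hx, straight_pos hv, irrational_of_straight hi, (lagrValue_straight hx).symm,
        h.straight hx hv⟩
  · exact big t v hi h3 h2 hv h

/-- Translations are undone until `t < 1`, which gains nothing new for multiples of (1, 0). The
first move of another kind completes the gain of one; `n` bounds the number of translations. -/
lemma GoodFromAux.exists {c : ℝ} {K : ℕ} (n : ℕ) : ∀ {t v : ℝ}, Irrational t → 0 < t → 0 < v →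
    t < n → GoodFromAux t v c K →
    ∃ t' v', 0 < t' ∧ 0 < v' ∧ Irrational t' ∧ lagrValue t' = lagrValue t ∧ GoodFrom t' v' c K := by
  induction n with
  | zero => intro t v _ h0 _ h1; simp at h1; linarith
  | succ n ih =>
    intro t v hi ht hv hn h
    have h1 := hi.ne_ratCast 1
    have h13 := hi.ne_ratCast (1 / 3)
    push_cast at h1 h13 hn
    rcases lt_or_gt_of_ne h1 with h1 | h1
    · rcases lt_or_gt_of_ne h13 with h3 | h3
      · have hd : 0 < 1 - 3 * t := by linarith
        have hx : 0 < t / (1 - 3 * t) := div_pos ht hd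
        have e : t = t / (1 - 3 * t) / (3 * (t / (1 - 3 * t)) + 1) := by
          have e1 : 3 * (t / (1 - 3 * t)) + 1 = 1 / (1 - 3 * t) := by
            obtain ⟨D, hD⟩ : ∃ D, D = 1 - 3 * t := ⟨_, rfl⟩
            rw [← hD] at hd ⊢
            field_simp
            rw [hD]; ring
          rw [e1, div_div_div_cancel_right₀ hd.ne', div_one]
        refine ⟨t / (1 - 3 * t), v + 1, hx, by linarith, ?_, ?_, ?_⟩
        · rintro ⟨r, hr⟩
          exact hi ⟨r / (3 * r + 1), by push_cast; rw [hr, ← e]⟩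
        · rw [← lagrValue_mirror hx, ← lagrValue_add_one, ← lagrValue_mirror ht]
          congr 1
          field_simp; ring
        · rw [e] at h
          exact h.inv_add hx hv
      · exact h.goodFrom.exists_of_mem_Ioo hi h3 h1 hv
    · have hi' : Irrational (t - 1) := by
        rintro ⟨r, hr⟩
        exact hi ⟨r + 1, by push_cast; linarith⟩
      obtain ⟨t', v', a, b, i, e, g⟩ := ih (v := v / (1 + 3 * v)) hi' (by linarith)
        (by positivity) (by linarith)
        (GoodFromAux.add_one (by linarith) hv (by rwa [sub_add_cancel]))
      exact ⟨t', v', a, b, i, by rw [e, ← lagrValue_add_one, sub_add_cancel], g⟩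

lemma GoodFrom.exists_goodFrom_zero {c : ℝ} (K : ℕ) : ∀ {t v : ℝ}, Irrational t → 0 < t → 0 < v →
    GoodFrom t v c K →
    ∃ t' v', 0 < t' ∧ 0 < v' ∧ lagrValue t' = lagrValue t ∧ GoodFrom t' v' c 0 := by
  induction K with
  | zero => exact fun {t v} _ ht hv h => ⟨t, v, ht, hv, rfl, h⟩
  | succ K ih =>
    intro t v hi ht hv h
    suffices ∃ t' v', 0 < t' ∧ 0 < v' ∧ Irrational t' ∧ lagrValue t' = lagrValue t ∧
        GoodFrom t' v' c K by
      obtain ⟨t', v', a, b, i, e, g⟩ := this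
      obtain ⟨t'', v'', a', b', e', g'⟩ := ih i a b g
      exact ⟨t'', v'', a', b', e'.trans e, g'⟩
    have big : ∀ t v : ℝ, Irrational t → 1 < t → 0 < v → GoodFrom t v c (K + 1) →
        ∃ t' v', 0 < t' ∧ 0 < v' ∧ Irrational t' ∧ lagrValue t' = lagrValue t ∧
          GoodFrom t' v' c K := by
      intro t v hi h1 hv h
      have hi' : Irrational (t - 1) := by
        rintro ⟨r, hr⟩
        exact hi ⟨r + 1, by push_cast; linarith⟩
      obtain ⟨n, hn⟩ := exists_nat_gt (t - 1)
      obtain ⟨t', v', a, b, i, e, g⟩ := GoodFromAux.exists n (v := v / (1 + 3 * v)) hi'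
        (by linarith) (by positivity) hn
        (GoodFrom.aux_of_add_one (by linarith) hv (by rwa [sub_add_cancel]))
      exact ⟨t', v', a, b, i, by rw [e, ← lagrValue_add_one, sub_add_cancel], g⟩
    have h1 := hi.ne_ratCast 1
    have h13 := hi.ne_ratCast (1 / 3)
    push_cast at h1 h13
    rcases lt_or_gt_of_ne h1 with h1 | h1
    · rcases lt_or_gt_of_ne h13 with h3 | h3
      · obtain ⟨t', v', a, b, i, e, g⟩ := big (1 / (3 * t)) (1 / (3 * v)) (irrational_mirror hi)
          (by rw [lt_div_iff₀ (by positivity)]; linarith) (by positivity) (h.mirror ht hv)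
        exact ⟨t', v', a, b, i, e.trans (lagrValue_mirror ht), g⟩
      · exact h.exists_of_mem_Ioo hi h3 h1 hv
    · exact big t v hi h1 hv h

/-! ### Lagrange constants against form values -/

/-- A large lattice point either has linear factor p - τ q bounded away from 0, and then a large
value, or lies near the line p = τ q, where the normalized form is close to q |p - τ q|. -/
lemma Lagr.exists_le_formVal {τ ν c c' : ℝ} (hτ : 0 < τ) (hν : 0 < ν) (h0 : 0 < c') (hc : c' < c)
    (h : Lagr τ c) : ∃ K : ℕ, ∀ p q : ℕ, K ≤ p + q → c' ≤ formVal τ ν p q := by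
  obtain ⟨K, hK⟩ := h
  set A := τ * ν + 1 with hA
  have hA0 : 0 < A := by positivity
  set ε := min 1 ((c - c') * τ) with hε
  have hε0 : 0 < ε := lt_min one_pos (mul_pos (by linarith) hτ)
  set m := min ν 1 with hm
  have hm0 : 0 < m := lt_min hν one_pos
  -- The first summand settles points with |p - τ q| ≥ ε; the second forces q ≥ K when |p - τ q| <
  -- 1.
  obtain ⟨N, hN⟩ := exists_nat_gt (c' * A / (m * ε) + (τ + 1) * K + 1)
  refine ⟨N, fun p q hpq => ?_⟩
  by_contra hlt
  push Not at hlt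
  have hB : 0 ≤ c' * A / (m * ε) := by positivity
  have hKτ : 0 ≤ (τ + 1) * K := by positivity
  have hpqN : (N : ℝ) ≤ p + q := by exact_mod_cast hpq
  rw [formVal, div_lt_iff₀ hA0] at hlt
  set x := (p : ℝ) - τ * q with hx
  have hp0 : (0 : ℝ) ≤ p := Nat.cast_nonneg p
  have hq0 : (0 : ℝ) ≤ q := Nat.cast_nonneg q
  have hlow : m * (p + q) ≤ ν * p + q := by
    have h1 : m * p ≤ ν * p := mul_le_mul_of_nonneg_right (min_le_left _ _) hp0
    have h2 : m * q ≤ 1 * q := mul_le_mul_of_nonneg_right (min_le_right _ _) hq0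
    linarith
  have hxε : |x| < ε := by
    by_contra hcon
    push Not at hcon
    have h1 : ε * (m * (p + q)) ≤ |x| * (ν * p + q) :=
      mul_le_mul hcon hlow (by positivity) (abs_nonneg _)
    have h2 : c' * A / (m * ε) < p + q := by linarith
    rw [div_lt_iff₀ (by positivity)] at h2
    linarith
  have hx1 : |x| < 1 := hxε.trans_le (min_le_left _ _)
  have hq : (K : ℝ) ≤ q := by
    have h1 := (abs_lt.1 hx1).2
    have h2 : (τ + 1) * K ≤ (τ + 1) * q := by
      have : (p : ℝ) + q = x + (τ + 1) * q := by rw [hx]; ring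
      linarith
    exact le_of_mul_le_mul_left h2 (by positivity)
  have key := hK q (by exact_mod_cast hq) (p : ℤ)
  rw [Int.cast_natCast, ← hx] at key
  have e : |x| * (ν * p + q) = ν * (|x| * x) + A * (q * |x|) := by rw [hx, hA]; ring
  have e1 : -(|x| * |x|) ≤ |x| * x := by
    have := mul_le_mul_of_nonneg_left (neg_abs_le x) (abs_nonneg x)
    linarith
  have e2 : |x| * |x| < (c - c') * τ * 1 := by
    apply mul_lt_mul'' (hxε.trans_le (min_le_right _ _)) hx1 (abs_nonneg _) (abs_nonneg _)
  have e3 : A * c ≤ A * (q * |x|) := mul_le_mul_of_nonneg_left key hA0.le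
  have e4 : ν * (|x| * |x|) ≤ ν * ((c - c') * τ) := mul_le_mul_of_nonneg_left (by linarith) hν.le
  have e5 : -(ν * (|x| * |x|)) ≤ ν * (|x| * x) := by
    have := mul_le_mul_of_nonneg_left e1 hν.le
    linarith
  have e6 : A * (c - c') = ν * ((c - c') * τ) + (c - c') := by rw [hA]; ring
  linarith

lemma lagr_of_le_formVal {τ ν c c' : ℝ} (hτ : 0 < τ) (hν : 0 < ν) (h0 : 0 < c') (hc : c' < c)
    (h : ∃ K : ℕ, ∀ p q : ℕ, 0 < p → K ≤ q → c ≤ formVal τ ν p q) : Lagr τ c' := by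
  obtain ⟨K, hK⟩ := h
  set A := τ * ν + 1 with hA
  have hA0 : 0 < A := by positivity
  set ε := min 1 ((c - c') * τ) with hε
  have hε0 : 0 < ε := lt_min one_pos (mul_pos (by linarith) hτ)
  obtain ⟨N, hN⟩ := exists_nat_gt (c' / ε + 1 / τ + K + 1)
  refine ⟨N, fun q hq p => ?_⟩
  by_contra hlt
  push Not at hlt
  have hB : 0 ≤ c' / ε := by positivity
  have hT : 0 ≤ 1 / τ := by positivity
  have hK0 : (0 : ℝ) ≤ K := Nat.cast_nonneg K
  have hqN : (N : ℝ) ≤ q := by exact_mod_cast hq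
  have hq0 : (0 : ℝ) < q := by linarith
  set x := (p : ℝ) - τ * q with hx
  have hxε : |x| < ε := by
    have h1 : c' / ε < q := by linarith
    rw [div_lt_iff₀ hε0] at h1
    exact lt_of_mul_lt_mul_left (hlt.trans h1) hq0.le
  have hx1 : |x| < 1 := hxε.trans_le (min_le_left _ _)
  have hp0 : 0 < p := by
    have h1 : 1 / τ < q := by linarith
    rw [div_lt_iff₀ hτ] at h1
    have h2 := (abs_lt.1 hx1).1
    have : (0 : ℝ) < p := by
      have : (p : ℝ) = x + τ * q := by rw [hx]; ring
      linarith
    exact_mod_cast this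
  lift p to ℕ using hp0.le
  have hKq : (K : ℝ) ≤ q := by linarith
  have key := hK p q (by exact_mod_cast hp0) (by exact_mod_cast hKq)
  rw [Int.cast_natCast] at hx
  rw [formVal, le_div_iff₀ hA0, ← hx] at key
  have e : |x| * (ν * p + q) = ν * (|x| * x) + A * (q * |x|) := by rw [hx, hA]; ring
  have e1 : |x| * x ≤ |x| * |x| := mul_le_mul_of_nonneg_left (le_abs_self x) (abs_nonneg x)
  have e2 : |x| * |x| < (c - c') * τ * 1 := by
    apply mul_lt_mul'' (hxε.trans_le (min_le_right _ _)) hx1 (abs_nonneg _) (abs_nonneg _)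
  have e3 : A * (q * |x|) ≤ A * c' := mul_le_mul_of_nonneg_left hlt.le hA0.le
  have e4 : ν * (|x| * |x|) ≤ ν * ((c - c') * τ) := mul_le_mul_of_nonneg_left (by linarith) hν.le
  have e5 : ν * (|x| * x) ≤ ν * (|x| * |x|) := mul_le_mul_of_nonneg_left e1 hν.le
  have e6 : A * (c - c') = ν * ((c - c') * τ) + (c - c') := by rw [hA]; ring
  linarith

lemma LagrPair.exists_goodFrom {t v c c' : ℝ} (ht : 0 < t) (hv : 0 < v) (h0 : 0 < c')
    (hc : c' < c) (h : LagrPair t c) : ∃ K, GoodFrom t v c' K := by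
  obtain ⟨K, hK⟩ := h.1.exists_le_formVal (ν := 3 * v) ht (by positivity) h0 hc
  obtain ⟨L, hL⟩ := h.2.exists_le_formVal (ν := v) (by positivity) hv h0 hc
  exact ⟨max K L, fun p q _ hpq =>
    ⟨hK p q ((le_max_left _ _).trans hpq), hL p q ((le_max_right _ _).trans hpq)⟩⟩

lemma GoodFrom.lagrPair {t v c c' : ℝ} {K : ℕ} (ht : 0 < t) (hv : 0 < v) (h0 : 0 < c')
    (hc : c' < c) (h : GoodFrom t v c K) : LagrPair t c' :=
  ⟨lagr_of_le_formVal (ν := 3 * v) ht (by positivity) h0 hc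
      ⟨K, fun p q hp hq => (h p q (by omega) (by omega)).1⟩,
    lagr_of_le_formVal (ν := v) (by positivity) hv h0 hc
      ⟨K, fun p q hp hq => (h p q (by omega) (by omega)).2⟩⟩

/-- A rational τ has q |p - τ q| = 0 for arbitrarily large q. Irrationality keeps `t` off the
boundary points between the moves. -/
lemma Lagr.irrational {τ c : ℝ} (h0 : 0 < c) (h : Lagr τ c) : Irrational τ := by
  rintro ⟨r, rfl⟩
  obtain ⟨K, hK⟩ := h
  have := hK ((K + 1) * r.den) (by nlinarith [r.pos]) ((K + 1) * r.num)
  have e : (((K + 1) * r.num : ℤ) : ℝ) - r * (((K + 1) * r.den : ℕ) : ℝ) = 0 := by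
    have h1 : (r : ℝ) * r.den = r.num := by exact_mod_cast Rat.mul_den_eq_num r
    push_cast
    linear_combination (-(K + 1 : ℝ)) * h1
  rw [e] at this
  simp at this
  linarith

/-- Values of `lagrValue` are witnessed by states without exceptional lattice points. -/
lemma exists_goodFrom_zero_of_lt {t c : ℝ} (ht : 0 < t) (h0 : 0 < c)
    (h : ENNReal.ofReal (Real.sqrt 3 * c) < lagrValue t) :
    ∃ t' v', 0 < t' ∧ 0 < v' ∧ lagrValue t' = lagrValue t ∧ GoodFrom t' v' c 0 := by
  obtain ⟨c', hc, hp⟩ := exists_lagrPair_of_lt_lagrValue h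
  obtain ⟨K, hK⟩ := hp.exists_goodFrom ht one_pos h0 hc
  exact hK.exists_goodFrom_zero K (hp.1.irrational (h0.trans hc)) ht one_pos

lemma GoodFrom.irrational {t v c : ℝ} {K : ℕ} (ht : 0 < t) (hv : 0 < v) (h0 : 0 < c)
    (h : GoodFrom t v c K) : Irrational t :=
  (h.lagrPair ht hv (half_pos h0) (half_lt_self h0)).1.irrational (half_pos h0)

/-! ### Constraints on states with all values at least 1/4 -/

/-- This is the value at (1, 0) on the second lattice. The bracket is the distance between the roots
3t and -1/v; `GoodFrom.height_zero` is its mirror image, from (0, 1) on the first lattice. -/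
lemma GoodFrom.height_inf {t v c : ℝ} (ht : 0 < t) (hv : 0 < v) (h : GoodFrom t v c 0) :
    c * (3 * t + 1 / v) ≤ 1 := by
  have := (h 1 0 (by norm_num) (by norm_num)).2
  rw [formVal, le_div_iff₀ (by positivity)] at this
  simp at this
  have e : c * (3 * t + 1 / v) = c * (3 * t * v + 1) / v := by field_simp
  rw [e, div_le_one hv]
  exact this

lemma GoodFrom.height_zero {t v c : ℝ} (ht : 0 < t) (hv : 0 < v) (h : GoodFrom t v c 0) :
    c * (3 * v + 1 / t) ≤ 1 := by
  have := (h 0 1 (by norm_num) (by norm_num)).1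
  rw [formVal, le_div_iff₀ (by positivity)] at this
  simp [abs_of_pos ht] at this
  have e : c * (3 * v + 1 / t) = c * (t * (3 * v) + 1) / t := by field_simp
  rw [e, div_le_one ht]
  exact this

/-- All lattice points of the positive quadrant have value at least `1/4`. -/
abbrev IsGood (t v : ℝ) : Prop := GoodFrom t v (1 / 4) 0

lemma IsGood.ineq_inf {t v : ℝ} (ht : 0 < t) (hv : 0 < v) (h : IsGood t v) :
    (3 * t) * v + 1 ≤ 4 * v := by
  have := GoodFrom.height_inf ht hv h
  have e : 1 / 4 * (3 * t + 1 / v) = (3 * t * v + 1) / (4 * v) := by field_simp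
  rw [e, div_le_one (by positivity)] at this
  exact this

lemma IsGood.ineq_zero {t v : ℝ} (ht : 0 < t) (hv : 0 < v) (h : IsGood t v) :
    (3 * v) * t + 1 ≤ 4 * t := by
  have := GoodFrom.height_zero ht hv h
  have e : 1 / 4 * (3 * v + 1 / t) = (3 * v * t + 1) / (4 * t) := by field_simp
  rw [e, div_le_one (by positivity)] at this
  exact this

/-- If t > 1, the condition at zero after undoing a translation gives t ≥ 5/4. The condition at
infinity then gives v ≥ 4, which violates the condition at zero for the original state. -/
lemma IsGood.lt_one {t v : ℝ} (ht : 0 < t) (hv : 0 < v) (h : IsGood t v) : t < 1 := by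
  have hi := GoodFrom.irrational ht hv (by norm_num) h
  by_contra hcon
  have h1 : 1 < t := lt_of_le_of_ne (not_lt.1 hcon) (by simpa using (hi.ne_ratCast 1).symm)
  have hx : 0 < t - 1 := by linarith
  have hw : 0 < v / (1 + 3 * v) := by positivity
  have h2 : IsGood (t - 1) (v / (1 + 3 * v)) :=
    GoodFrom.add_one hx hv (by rwa [sub_add_cancel])
  have a1 := h2.ineq_zero hx hw
  have a2 := h.ineq_inf ht hv
  have a3 := h.ineq_zero ht hv
  have h3 : 5 / 4 ≤ t := by
    have := mul_pos hw hx
    linarith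
  have h4 : 4 ≤ v := by nlinarith
  nlinarith

lemma IsGood.mirror {t v : ℝ} (ht : 0 < t) (hv : 0 < v) (h : IsGood t v) :
    IsGood (1 / (3 * t)) (1 / (3 * v)) := GoodFrom.mirror ht hv h

lemma IsGood.third_lt {t v : ℝ} (ht : 0 < t) (hv : 0 < v) (h : IsGood t v) : 1 / 3 < t := by
  have := (h.mirror ht hv).lt_one (by positivity) (by positivity)
  rw [div_lt_one (by positivity)] at this
  linarith

lemma IsGood.second_lt_one {t v : ℝ} (ht : 0 < t) (hv : 0 < v) (h : IsGood t v) : v < 1 := by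
  have a1 := h.ineq_zero ht hv
  have := h.lt_one ht hv
  by_contra hcon
  push Not at hcon
  nlinarith

/-- For v ≤ 7/12 the condition at infinity gives t ≤ 16/21. If t = θ(x), then x ≥ 5/6, so x = θ(y)
with y ≤ 1/3, which `IsGood.third_lt` excludes. -/
lemma IsGood.lt_two_thirds {t v : ℝ} (ht : 0 < t) (hv : 0 < v) (h : IsGood t v)
    (hv' : v ≤ 7 / 12) : t < 2 / 3 := by
  have hi := GoodFrom.irrational ht hv (by norm_num) h
  by_contra hcon
  have h1 : 2 / 3 < t := lt_of_le_of_ne (not_lt.1 hcon) (by simpa using (hi.ne_ratCast (2/3)).symm)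
  obtain ⟨x, hx, rfl⟩ := exists_eq_theta h1 (h.lt_one ht hv)
  have a := h.ineq_inf ht hv
  have g : IsGood x (theta v) := GoodFrom.theta hx hv h
  have hx1 := g.lt_one hx (theta_pos hv)
  have hx5 : 5 / 6 ≤ x := by
    have h2 : theta x ≤ 16 / 21 := by nlinarith
    unfold theta at h2
    rw [div_le_iff₀ (by positivity)] at h2
    linarith
  obtain ⟨y, hy, rfl⟩ := exists_eq_theta (by linarith) hx1
  have g' : IsGood y (theta (theta v)) := GoodFrom.theta hy (theta_pos hv) g
  have hy3 := g'.third_lt hy (theta_pos (theta_pos hv))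
  unfold theta at hx5
  rw [le_div_iff₀ (by positivity)] at hx5
  linarith

lemma IsGood.half_lt {t v : ℝ} (ht : 0 < t) (hv : 0 < v) (h : IsGood t v)
    (hv' : 4 / 7 ≤ v) : 1 / 2 < t := by
  have := (h.mirror ht hv).lt_two_thirds (by positivity) (by positivity)
    (by rw [div_le_iff₀ (by positivity)]; linarith)
  rw [div_lt_iff₀ (by positivity)] at this
  linarith

lemma IsGood.ne_two_thirds {t v : ℝ} (ht : 0 < t) (hv : 0 < v) (h : IsGood t v) : t ≠ 2 / 3 := by
  simpa using (GoodFrom.irrational ht hv (by norm_num) h).ne_ratCast (2/3)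

lemma IsGood.ne_half {t v : ℝ} (ht : 0 < t) (hv : 0 < v) (h : IsGood t v) : t ≠ 1 / 2 := by
  simpa using (GoodFrom.irrational ht hv (by norm_num) h).ne_ratCast (1/2)

/-! ### Codings that go straight on for ever -/

/-- A point that stays in a bounded set under arbitrary backward iteration of a contraction is the
fixed point. -/
lemma eq_of_forall_exists_preimage {f : ℝ → ℝ} {Y : Set ℝ} {u : ℝ}
    (hf : ∀ x ∈ Y, |f x - u| ≤ |x - u| / 2) (hY : ∀ x ∈ Y, ∃ x' ∈ Y, x = f x')
    (hb : ∀ x ∈ Y, |x - u| ≤ 1) : ∀ x ∈ Y, x = u := by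
  have key : ∀ n : ℕ, ∀ x ∈ Y, |x - u| ≤ (1 / 2) ^ n := by
    intro n
    induction n with
    | zero => simpa using hb
    | succ n ih =>
      intro x hx
      obtain ⟨x', hx', rfl⟩ := hY x hx
      have h1 := hf x' hx'
      have h2 := ih x' hx'
      rw [pow_succ]
      linarith
  intro x hx
  have h0 : |x - u| ≤ 0 := ge_of_tendsto'
    (tendsto_pow_atTop_nhds_zero_of_lt_one (by norm_num) (by norm_num)) fun n => key n x hx
  exact sub_eq_zero.1 (abs_eq_zero.1 (le_antisymm h0 (abs_nonneg _)))

lemma abs_straight_sub_le {x y : ℝ} (hx : 0 < x) (hy : 0 < y) :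
    |straight x - straight y| ≤ |x - y| / 2 := by
  have e : straight x - straight y = (x - y) / ((3 * x + 2) * (3 * y + 2)) := by
    unfold straight; field_simp; ring
  rw [e, abs_div, abs_of_pos (by positivity : 0 < (3 * x + 2) * (3 * y + 2))]
  apply div_le_div_of_nonneg_left (abs_nonneg _) (by norm_num)
  nlinarith [mul_pos hx hy]

lemma abs_theta_sub_le {x y : ℝ} (hx : 0 < x) (hy : 0 < y) :
    |theta x - theta y| ≤ |x - y| := by
  have e : theta x - theta y = -((x - y) / ((3 * x + 1) * (3 * y + 1))) := by
    unfold theta; field_simp; ring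
  rw [e, abs_neg, abs_div, abs_of_pos (by positivity : 0 < (3 * x + 1) * (3 * y + 1))]
  apply div_le_self (abs_nonneg _)
  nlinarith [mul_pos hx hy]

lemma theta_iterate_pos (k : ℕ) {x : ℝ} (hx : 0 < x) : 0 < theta^[k] x := by
  induction k with
  | zero => exact hx
  | succ k ih => rw [Function.iterate_succ_apply']; exact theta_pos ih

lemma abs_theta_iterate_sub_le (k : ℕ) {x y : ℝ} (hx : 0 < x) (hy : 0 < y) :
    |theta^[k] x - theta^[k] y| ≤ |x - y| := by
  induction k with
  | zero => exact le_rfl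
  | succ k ih =>
    rw [Function.iterate_succ_apply', Function.iterate_succ_apply']
    exact (abs_theta_sub_le (theta_iterate_pos k hx) (theta_iterate_pos k hy)).trans ih

lemma lagrValue_theta_iterate (k : ℕ) {x : ℝ} (hx : 0 < x) :
    lagrValue (theta^[k] x) = lagrValue x := by
  induction k with
  | zero => rfl
  | succ k ih =>
    rw [Function.iterate_succ_apply', lagrValue_theta (theta_iterate_pos k hx), ih]

/-- After two `straight` moves the past lies in [4/7, 7/12]. Such a past forces the next move to be
`straight` as well, so this interval is never left. -/
lemma straight_mem {v : ℝ} (h1 : 1 / 2 ≤ v) (h2 : v ≤ 2 / 3) :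
    4 / 7 ≤ straight v ∧ straight v ≤ 7 / 12 := by
  unfold straight
  constructor
  · rw [le_div_iff₀ (by linarith)]; linarith
  · rw [div_le_iff₀ (by linarith)]; linarith

lemma two_thirds_lt_theta {x : ℝ} (hx : 0 < x) : 2 / 3 < theta x := by
  unfold theta
  rw [lt_div_iff₀ (by positivity)]; linarith

lemma theta_lt_one {x : ℝ} (hx : 0 < x) : theta x < 1 := by
  unfold theta
  rw [div_lt_one (by positivity)]; linarith

lemma straight_lt_two_thirds {x : ℝ} (hx : 0 < x) : straight x < 2 / 3 := by
  unfold straight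
  rw [div_lt_iff₀ (by positivity)]; linarith

lemma half_lt_straight {x : ℝ} (hx : 0 < x) : 1 / 2 < straight x := by
  unfold straight
  rw [lt_div_iff₀ (by positivity)]; linarith

/-- The state whose coding goes straight on for ever. -/
lemma IsGood.eq_inv_sqrt_three {t v : ℝ} (ht : 0 < t) (h : IsGood t v) (h1 : 4 / 7 ≤ v)
    (h2 : v ≤ 7 / 12) : t = 1 / Real.sqrt 3 := by
  have h3 := sqrt_three_pos
  have hs : Real.sqrt 3 * Real.sqrt 3 = 3 := Real.mul_self_sqrt (by norm_num)
  have hu : 0 < 1 / Real.sqrt 3 := by positivity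
  have hfix : straight (1 / Real.sqrt 3) = 1 / Real.sqrt 3 := by
    unfold straight
    rw [div_eq_div_iff (by positivity) h3.ne']
    field_simp
    linarith
  have hu1 : 1 / Real.sqrt 3 < 1 := by
    rw [div_lt_one h3]; nlinarith
  refine eq_of_forall_exists_preimage (f := straight)
    (Y := {t | 0 < t ∧ ∃ v, 4 / 7 ≤ v ∧ v ≤ 7 / 12 ∧ IsGood t v}) ?_ ?_ ?_ t ⟨ht, v, h1, h2, h⟩
  · rintro x ⟨hx, -⟩
    have := abs_straight_sub_le hx hu
    rwa [hfix] at this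
  · rintro x ⟨hx, v, h1, h2, h⟩
    have hv : 0 < v := by linarith
    obtain ⟨x', hx', rfl⟩ := exists_eq_straight (h.half_lt hx hv h1) (h.lt_two_thirds hx hv h2)
    have := straight_mem (v := v) (by linarith) (by linarith)
    exact ⟨x', ⟨hx', straight v, this.1, this.2, GoodFrom.straight hx' hv h⟩, rfl⟩
  · rintro x ⟨hx, v, h1, h2, h⟩
    have := h.lt_one hx (by linarith)
    rw [abs_le]; constructor <;> linarith

/-! ### Blocks of `theta` moves and turns -/

/-- The positive fixed point of `theta`. -/
noncomputable def thetaFix : ℝ := (1 + Real.sqrt 13) / 6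

lemma thetaFix_sq : 3 * thetaFix ^ 2 = thetaFix + 1 := by
  have : Real.sqrt 13 ^ 2 = 13 := Real.sq_sqrt (by norm_num)
  unfold thetaFix
  linear_combination this / 12

lemma thetaFix_gt : 0.7675 < thetaFix := by
  have : (3.605 : ℝ) < Real.sqrt 13 := Real.lt_sqrt_of_sq_lt (by norm_num)
  unfold thetaFix; linarith

lemma thetaFix_lt : thetaFix < 0.7676 := by
  have : Real.sqrt 13 < (3.6056 : ℝ) := (Real.sqrt_lt' (by norm_num)).2 (by norm_num)
  unfold thetaFix; linarith

lemma thetaFix_pos : 0 < thetaFix := by have := thetaFix_gt; linarith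

lemma theta_thetaFix : theta thetaFix = thetaFix := by
  have := thetaFix_sq
  have h0 := thetaFix_pos
  unfold theta
  rw [div_eq_iff (by positivity)]
  linarith

lemma abs_theta_sub_thetaFix_le {x : ℝ} (hx : 0 < x) :
    |theta x - thetaFix| ≤ |x - thetaFix| / 2 := by
  have h0 := thetaFix_gt
  have h0' := thetaFix_pos
  have e : theta x - theta thetaFix
      = -((x - thetaFix) / ((3 * x + 1) * (3 * thetaFix + 1))) := by
    unfold theta; field_simp; ring
  rw [← theta_thetaFix, e, theta_thetaFix, abs_neg, abs_div,
    abs_of_pos (by positivity : 0 < (3 * x + 1) * (3 * thetaFix + 1))]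
  apply div_le_div_of_nonneg_left (abs_nonneg _) (by norm_num)
  nlinarith [mul_pos hx h0']

/-- The two good states on both sides of a `straight` move between two `theta` moves. -/
structure IsTurn (u v : ℝ) : Prop where
  left : 2 / 3 < u
  right : 2 / 3 < v
  before : IsGood (straight u) v
  after : IsGood u (straight v)

lemma IsTurn.left_lt {u v : ℝ} (h : IsTurn u v) : u < 1 :=
  h.after.lt_one (by linarith [h.left]) (straight_pos (by linarith [h.right]))

lemma IsTurn.right_lt {u v : ℝ} (h : IsTurn u v) : v < 1 :=
  h.before.second_lt_one (straight_pos (by linarith [h.left])) (by linarith [h.right])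

/-- After a `theta` move, the coding continues with `theta` moves up to the next turn. -/
lemma IsGood.exists_isTurn {t v : ℝ} (ht : 0 < t) (h : IsGood t v) (hv : 2 / 3 < v) :
    t = thetaFix ∨ lagrValue t = lagrValue (1 / Real.sqrt 3) ∨
      ∃ i u, t = theta^[i] (straight u) ∧ IsTurn u (theta^[i] v) := by
  by_contra hcon
  refine hcon (Or.inl ?_)
  refine eq_of_forall_exists_preimage (f := theta)
    -- The set of states that reach neither a turn nor the straight coding is closed under taking
    -- off a `theta` move, so the contraction principle collapses it to the fixed point.
    (Y := {t | 0 < t ∧ ∃ v, 2 / 3 < v ∧ IsGood t v ∧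
      ¬(lagrValue t = lagrValue (1 / Real.sqrt 3) ∨
        ∃ i u, t = theta^[i] (straight u) ∧ IsTurn u (theta^[i] v))}) ?_ ?_ ?_ t
        ⟨ht, v, hv, h, fun hh => hcon (Or.inr hh)⟩
  · rintro x ⟨hx, -⟩
    exact abs_theta_sub_thetaFix_le hx
  · rintro x ⟨hx, v, hv, h, hn⟩
    have hv0 : 0 < v := by linarith
    rcases lt_or_gt_of_ne (h.ne_two_thirds hx hv0) with h1 | h1
    · exfalso
      apply hn
      obtain ⟨u, hu, rfl⟩ := exists_eq_straight (h.half_lt hx hv0 (by linarith)) h1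
      have g : IsGood u (straight v) := GoodFrom.straight hu hv0 h
      have hv1 := h.second_lt_one hx hv0
      have hs : 7 / 12 ≤ straight v := by
        unfold straight; rw [le_div_iff₀ (by positivity)]; linarith
      rcases lt_or_gt_of_ne (g.ne_two_thirds hu (straight_pos hv0)) with h2 | h2
      · left
        have h3 := g.half_lt hu (straight_pos hv0) (by linarith)
        obtain ⟨w, hw, rfl⟩ := exists_eq_straight h3 h2
        have g' : IsGood w (straight (straight v)) := GoodFrom.straight hw (straight_pos hv0) g
        have m := straight_mem (half_lt_straight hv0).le (straight_lt_two_thirds hv0).le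
        rw [lagrValue_straight hu, lagrValue_straight hw, g'.eq_inv_sqrt_three hw m.1 m.2]
      · exact Or.inr ⟨0, u, rfl, h2, hv, h, g⟩
    · obtain ⟨x', hx', rfl⟩ := exists_eq_theta h1 (h.lt_one hx hv0)
      refine ⟨x', ⟨hx', theta v, two_thirds_lt_theta hv0, GoodFrom.theta hx' hv0 h, ?_⟩, rfl⟩
      rintro (h3 | ⟨i, u, rfl, h3⟩)
      · exact hn (Or.inl (by rw [lagrValue_theta hx', h3]))
      · exact hn (Or.inr ⟨i + 1, u, by rw [Function.iterate_succ_apply'],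
          by rwa [Function.iterate_succ_apply]⟩)
  · rintro x ⟨hx, v, h1, h, -⟩
    have := h.lt_one hx (by linarith)
    have := thetaFix_gt
    have := thetaFix_lt
    rw [abs_le]; constructor <;> linarith

/-- The future of a turn starts with `theta`, so `IsGood.exists_isTurn` applies after that move;
hence the next block has length at least one. -/
lemma IsTurn.exists_isTurn {u v : ℝ} (h : IsTurn u v) :
    lagrValue u = lagrValue thetaFix ∨ lagrValue u = lagrValue (1 / Real.sqrt 3) ∨
      ∃ k u', 1 ≤ k ∧ u = theta^[k] (straight u') ∧ IsTurn u' (theta^[k] (straight v)) := by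
  have hv : 0 < v := by linarith [h.right]
  obtain ⟨x, hx, rfl⟩ := exists_eq_theta h.left h.left_lt
  have g : IsGood x (theta (straight v)) := GoodFrom.theta hx (straight_pos hv) h.after
  rw [lagrValue_theta hx]
  rcases g.exists_isTurn hx (two_thirds_lt_theta (straight_pos hv)) with h1 | h1 | ⟨i, u, rfl, h1⟩
  · exact Or.inl (by rw [h1])
  · exact Or.inr (Or.inl h1)
  · exact Or.inr (Or.inr ⟨i + 1, u, by omega, by rw [Function.iterate_succ_apply'],
      by rwa [Function.iterate_succ_apply]⟩)

/-! ### Linearization of `theta` and comparison of block lengths -/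

/-- The negative root of `3 x ^ 2 = x + 1`. -/
noncomputable def thetaConj : ℝ := 1 / 3 - thetaFix

/-- The coordinate in which `theta` is linear. -/
noncomputable def thetaCoord (x : ℝ) : ℝ := (thetaFix - x) / (x - thetaConj)

/-- The multiplier of `theta`. -/
noncomputable def thetaMult : ℝ := (3 * thetaConj + 1) / (3 * thetaFix + 1)

lemma thetaConj_neg : thetaConj < 0 := by unfold thetaConj; linarith [thetaFix_gt]

lemma thetaCoord_theta {x : ℝ} (hx : 0 < x) : thetaCoord (theta x) = thetaMult * thetaCoord x := by
  have hb := thetaConj_neg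
  have ha := thetaFix_pos
  have h1 : 0 < x - thetaConj := by linarith
  have h2 : 0 < theta x - thetaConj := by linarith [theta_pos hx]
  have h3 : (0 : ℝ) < 3 * thetaFix + 1 := by positivity
  have h4 : (0 : ℝ) < 3 * x + 1 := by positivity
  unfold thetaCoord thetaMult
  rw [div_mul_div_comm, div_eq_div_iff h2.ne' (by positivity)]
  unfold theta thetaConj
  have hsq := thetaFix_sq
  field_simp
  linear_combination (6 * thetaFix - 1) * (3 * x + 1) * hsq

lemma thetaCoord_iterate (k : ℕ) {x : ℝ} (hx : 0 < x) :
    thetaCoord (theta^[k] x) = thetaMult ^ k * thetaCoord x := by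
  induction k with
  | zero => simp
  | succ k ih =>
    rw [Function.iterate_succ_apply', thetaCoord_theta (theta_iterate_pos k hx), ih]
    ring

lemma thetaMult_mem : -0.0919 < thetaMult ∧ thetaMult < -0.0915 := by
  have h1 := thetaFix_gt
  have h2 := thetaFix_lt
  have h3 : (0 : ℝ) < 3 * thetaFix + 1 := by linarith
  unfold thetaMult thetaConj
  constructor
  · rw [lt_div_iff₀ h3]; linarith
  · rw [div_lt_iff₀ h3]; linarith

/-- The multiplier of the map `v ↦ (5 v + 2) / (6 v + 3)`, which has the fixed points of `theta`. -/
noncomputable def turnMult : ℝ := (6 * thetaConj + 3) / (6 * thetaFix + 3)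

lemma turnMult_mem : 0.05 < turnMult ∧ turnMult < 0.06 := by
  have h1 := thetaFix_gt
  have h2 := thetaFix_lt
  have hA : (0 : ℝ) < 6 * thetaFix + 3 := by linarith
  unfold turnMult thetaConj
  constructor
  · rw [lt_div_iff₀ hA]; linarith
  · rw [div_lt_iff₀ hA]; linarith

/-- The hypothesis says u ≤ (5v + 2)/(6v + 3). This Möbius map fixes both fixed points of `theta`,
so it is multiplication by `turnMult` in `thetaCoord`, and `thetaCoord` is decreasing. -/
lemma turnMult_mul_thetaCoord_le {u v : ℝ} (hu : 0 < u) (hv : 0 < v)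
    (h : (6 * v + 3) * u ≤ 5 * v + 2) : turnMult * thetaCoord v ≤ thetaCoord u := by
  have h1 := thetaFix_gt
  have hb := thetaConj_neg
  have hsq := thetaFix_sq
  have hpu : 0 < u - thetaConj := by linarith
  have hpv : 0 < v - thetaConj := by linarith
  have hA : (0 : ℝ) < 6 * thetaFix + 3 := by linarith
  unfold thetaCoord turnMult
  rw [div_mul_div_comm, div_le_div_iff₀ (by positivity) hpu]
  have e : (thetaFix - u) * ((6 * thetaFix + 3) * (v - thetaConj))
      - (6 * thetaConj + 3) * (thetaFix - v) * (u - thetaConj)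
      = (thetaFix - thetaConj) * ((5 * v + 2) - (6 * v + 3) * u) := by
    unfold thetaConj
    linear_combination (4 * thetaFix - 2 / 3) * hsq
  have : 0 ≤ (thetaFix - thetaConj) * ((5 * v + 2) - (6 * v + 3) * u) :=
    mul_nonneg (by linarith) (by linarith)
  linarith

lemma straight_mul {x : ℝ} (hx : 0 < x) : straight x * (3 * x + 2) = 2 * x + 1 := by
  unfold straight; field_simp

/-- Multiplying the height bound 3u + 1/`straight v` ≤ 4 by the denominators turns it into the
Möbius inequality. -/
lemma ineq_of_straight {u v : ℝ} (hv : 0 < v)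
    (a : (3 * u) * straight v + 1 ≤ 4 * straight v) : (6 * v + 3) * u ≤ 5 * v + 2 := by
  have hs := straight_mul hv
  have := mul_le_mul_of_nonneg_right a (by linarith : 0 ≤ 3 * v + 2)
  have e1 : (3 * u * straight v + 1) * (3 * v + 2) = 3 * u * (2 * v + 1) + (3 * v + 2) := by
    rw [← hs]; ring
  have e2 : 4 * straight v * (3 * v + 2) = 4 * (2 * v + 1) := by rw [← hs]; ring
  rw [e1, e2] at this
  linarith

lemma IsTurn.thetaCoord_le {u v : ℝ} (h : IsTurn u v) :
    turnMult * thetaCoord v ≤ thetaCoord u := by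
  have hu : 0 < u := by linarith [h.left]
  have hv : 0 < v := by linarith [h.right]
  exact turnMult_mul_thetaCoord_le hu hv
    (ineq_of_straight hv (h.after.ineq_inf hu (straight_pos hv)))

lemma IsTurn.thetaCoord_le' {u v : ℝ} (h : IsTurn u v) :
    turnMult * thetaCoord u ≤ thetaCoord v := by
  have hu : 0 < u := by linarith [h.left]
  have hv : 0 < v := by linarith [h.right]
  exact turnMult_mul_thetaCoord_le hv hu
    (ineq_of_straight hu (h.before.ineq_zero (straight_pos hu) hv))

lemma thetaCoord_straight_mem {x : ℝ} (h1 : 2 / 3 < x) (h2 : x < 1) :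
    0.16 ≤ thetaCoord (straight x) ∧ thetaCoord (straight x) ≤ 0.182 := by
  have s1 : 7 / 12 ≤ straight x := by
    unfold straight; rw [le_div_iff₀ (by linarith)]; linarith
  have s2 : straight x ≤ 3 / 5 := by
    unfold straight; rw [div_le_iff₀ (by linarith)]; linarith
  have h1 := thetaFix_gt
  have h2 := thetaFix_lt
  unfold thetaCoord thetaConj
  constructor
  · rw [le_div_iff₀ (by linarith)]; linarith
  · rw [div_le_iff₀ (by linarith)]; linarith

/-- Comparison of consecutive numbers of `theta` moves. -/
lemma even_and_eq_of_mul_pow_le {r μ x y : ℝ} {k m : ℕ} (hr : -0.0919 < r ∧ r < -0.0915)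
    (hμ : 0.05 < μ ∧ μ < 0.06) (hx : 0.16 ≤ x ∧ x ≤ 0.182) (hy : 0.16 ≤ y ∧ y ≤ 0.182)
    (h1 : μ * (r ^ m * y) ≤ r ^ k * x) (h2 : μ * (r ^ k * x) ≤ r ^ m * y) : Even k ∧ k = m := by
  have hx0 : 0 < x := by linarith
  have hy0 : 0 < y := by linarith
  have hr0 : r < 0 := by linarith
  have hμ0 : 0 < μ := by linarith
  -- With A and B the two coordinates, μB ≤ A and μA ≤ B. A negative A would make B negative and
  -- give A ≤ A/μ², which is false because μ < 1. So both coordinates are positive and both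
  -- exponents even.
  have hek : Even k := by
    by_contra hk
    have hA : r ^ k * x < 0 := mul_neg_of_neg_of_pos ((Nat.not_even_iff_odd.1 hk).pow_neg hr0) hx0
    by_cases hm : Even m
    · have hB : 0 ≤ r ^ m * y := mul_nonneg (hm.pow_nonneg r) hy0.le
      nlinarith
    · have e := mul_le_mul_of_nonneg_left h2 hμ0.le
      have e' : μ * μ < 1 := by nlinarith
      nlinarith
  have hem : Even m := by
    by_contra hm
    have hB : r ^ m * y < 0 := mul_neg_of_neg_of_pos ((Nat.not_even_iff_odd.1 hm).pow_neg hr0) hy0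
    have hA : 0 ≤ r ^ k * x := mul_nonneg (hek.pow_nonneg r) hx0.le
    nlinarith
  refine ⟨hek, ?_⟩
  obtain ⟨i, rfl⟩ := hek.two_dvd
  obtain ⟨j, rfl⟩ := hem.two_dvd
  rw [pow_mul, pow_mul] at h1 h2
  have hR : 0 < r ^ 2 ∧ r ^ 2 < 0.0085 := by constructor <;> nlinarith
  -- Lengths that differ change the coordinate by a factor of at most r² < 0.0085, too small to be
  -- compensated by μ: 0.0085 · 0.182 < 0.05 · 0.16.
  have key : ∀ {i j : ℕ} {x y : ℝ}, (0.16 ≤ x ∧ x ≤ 0.182) → (0.16 ≤ y ∧ y ≤ 0.182) →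
      μ * ((r ^ 2) ^ i * x) ≤ (r ^ 2) ^ j * y → j ≤ i := by
    intro i j x y hx hy h
    by_contra hij
    push Not at hij
    have hp : 0 < (r ^ 2) ^ i := pow_pos hR.1 i
    have e1 : (r ^ 2) ^ j ≤ (r ^ 2) ^ i * r ^ 2 := by
      rw [← pow_succ]
      exact pow_le_pow_of_le_one hR.1.le (by linarith) hij
    have e2 : (r ^ 2) ^ j * y ≤ (r ^ 2) ^ i * (0.0085 * 0.182) := by
      calc (r ^ 2) ^ j * y ≤ ((r ^ 2) ^ i * r ^ 2) * y :=
            mul_le_mul_of_nonneg_right e1 (by linarith)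
        _ = (r ^ 2) ^ i * (r ^ 2 * y) := by ring
        _ ≤ _ := by
            apply mul_le_mul_of_nonneg_left _ hp.le
            exact mul_le_mul hR.2.le hy.2 (by linarith) (by norm_num)
    have e3 : (r ^ 2) ^ i * (0.05 * 0.16) ≤ μ * ((r ^ 2) ^ i * x) := by
      calc (r ^ 2) ^ i * (0.05 * 0.16) ≤ (r ^ 2) ^ i * (μ * x) := by
            apply mul_le_mul_of_nonneg_left _ hp.le
            exact mul_le_mul hμ.1.le hx.1 (by norm_num) hμ0.le
        _ = _ := by ring
    have e4 : (r ^ 2) ^ i * (0.0085 * 0.182) < (r ^ 2) ^ i * (0.05 * 0.16) :=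
      mul_lt_mul_of_pos_left (by norm_num) hp
    linarith
  have := key hx hy h2
  have := key hy hx h1
  omega

/-! ### Classification of the values above √3/4 -/

/-- The value of `lagrValue` on a state with the given periodic coding. -/
def IsClassified (y : ENNReal) : Prop :=
  y = lagrValue thetaFix ∨ y = lagrValue (1 / Real.sqrt 3) ∨
    ∃ k w, 1 ≤ k ∧ Even k ∧ 0 < w ∧ theta^[k] (straight w) = w ∧ y = lagrValue w

lemma theta_iterate_mem {k : ℕ} (hk : 1 ≤ k) {x : ℝ} (hx : 0 < x) :
    2 / 3 < theta^[k] x ∧ theta^[k] x < 1 := by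
  obtain ⟨j, rfl⟩ : ∃ j, k = j + 1 := ⟨k - 1, by omega⟩
  rw [Function.iterate_succ_apply']
  exact ⟨two_thirds_lt_theta (theta_iterate_pos j hx), theta_lt_one (theta_iterate_pos j hx)⟩

lemma exists_theta_iterate_straight_eq {k : ℕ} (hk : 1 ≤ k) :
    ∃ w, 0 < w ∧ theta^[k] (straight w) = w := by
  have hc : ∀ j : ℕ, ContinuousOn (fun x => theta^[j] (straight x)) (Set.Icc 0 1) := by
    intro j
    induction j with
    | zero =>
      have : ContinuousOn straight (Set.Icc 0 1) := by
        unfold straight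
        exact ContinuousOn.div (by fun_prop) (by fun_prop) fun x hx => by linarith [hx.1]
      simpa using this
    | succ j ih =>
      simp only [Function.iterate_succ_apply']
      have hθ : ContinuousOn theta (Set.Ioi 0) := by
        unfold theta
        exact ContinuousOn.div (by fun_prop) (by fun_prop) fun x hx => by
          have : (0 : ℝ) < x := hx
          linarith
      refine hθ.comp ih fun x hx => theta_iterate_pos j ?_
      have : 0 ≤ x := hx.1
      unfold straight
      positivity
  have h0 : 0 < straight 0 := by unfold straight; norm_num
  -- A fixed point by the intermediate value theorem: for k ≥ 1 the values at 0 and 1 lie strictly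
  -- between 2/3 and 1.
  obtain ⟨w, hw, hw0⟩ := intermediate_value_Icc' (zero_le_one' ℝ) ((hc k).sub continuousOn_id)
    (show (0 : ℝ) ∈ Set.Icc _ _ from ⟨by
      have := (theta_iterate_mem hk (straight_pos one_pos)).2
      simp only [Pi.sub_apply, id_eq]; linarith, by
      have := (theta_iterate_mem hk h0).1
      simp only [Pi.sub_apply, id_eq]; linarith⟩)
  have e : theta^[k] (straight w) = w := by
    simp only [Pi.sub_apply, id_eq] at hw0
    linarith
  refine ⟨w, ?_, e⟩
  rcases hw.1.lt_or_eq with h | h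
  · exact h
  · rw [← h] at e
    have := theta_iterate_pos k h0
    linarith

/-- A turn preceded by `k` moves `theta` and a further turn. -/
def IsTurnAfter (k : ℕ) (u v : ℝ) : Prop :=
  IsTurn u v ∧ ∃ v₀, 2 / 3 < v₀ ∧ v₀ < 1 ∧ v = theta^[k] (straight v₀)

/-- The next block is compared with the preceding block of length `k`; equal lengths let the same
`k` propagate to the next turn. -/
lemma IsTurnAfter.exists {k : ℕ} {u v : ℝ} (h : IsTurnAfter k u v) :
    IsClassified (lagrValue u) ∨ Even k ∧ ∃ u' v', u = theta^[k] (straight u') ∧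
      IsTurnAfter k u' v' := by
  obtain ⟨ht, v₀, h1, h2, rfl⟩ := h
  have hv₀ : 0 < v₀ := by linarith
  rcases ht.exists_isTurn with h | h | ⟨m, u', hm, rfl, h⟩
  · exact Or.inl (Or.inl h)
  · exact Or.inl (Or.inr (Or.inl h))
  · right
    have hu' : 0 < u' := by linarith [h.left]
    have c1 := ht.thetaCoord_le
    have c2 := ht.thetaCoord_le'
    rw [thetaCoord_iterate _ (straight_pos hu'), thetaCoord_iterate _ (straight_pos hv₀)] at c1 c2
    obtain ⟨e1, e2⟩ := even_and_eq_of_mul_pow_le thetaMult_mem turnMult_mem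
      (thetaCoord_straight_mem h.left h.left_lt) (thetaCoord_straight_mem h1 h2) c1 c2
    subst e2
    exact ⟨e1, u', _, rfl, h, _, ht.right, ht.right_lt, rfl⟩

/-- If the turns never stop, all further blocks have length `k`, so `u` has arbitrarily long
backward orbits under the contraction `theta^[k] ∘ straight` and equals its fixed point. -/
lemma IsTurnAfter.isClassified {k : ℕ} (hk : 1 ≤ k) {u v : ℝ} (h : IsTurnAfter k u v) :
    IsClassified (lagrValue u) := by
  by_contra hn
  obtain ⟨w, hw, hfix⟩ := exists_theta_iterate_straight_eq hk
  have hw1 := theta_iterate_mem hk (straight_pos hw)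
  rw [hfix] at hw1
  have hpos : ∀ {x y}, IsTurnAfter k x y → 0 < x := fun h => by linarith [h.1.left]
  have hstep : ∀ {x y}, IsTurnAfter k x y → lagrValue x = lagrValue u →
      Even k ∧ ∃ u' v', x = theta^[k] (straight u') ∧ IsTurnAfter k u' v' := by
    intro x y hx he
    rcases hx.exists with h | h
    · rw [he] at h; exact absurd h hn
    · exact h
  have key := eq_of_forall_exists_preimage (f := fun x => theta^[k] (straight x)) (u := w)
    (Y := {x | ∃ v, IsTurnAfter k x v ∧ lagrValue x = lagrValue u}) ?_ ?_ ?_ u ⟨v, h, rfl⟩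
  · exact hn (Or.inr (Or.inr ⟨k, w, hk, (hstep h rfl).1, hw, hfix, by rw [key]⟩))
  · rintro x ⟨y, hx, -⟩
    conv_lhs => rw [← hfix]
    exact (abs_theta_iterate_sub_le k (straight_pos (hpos hx)) (straight_pos hw)).trans
      (abs_straight_sub_le (hpos hx) hw)
  · rintro x ⟨y, hx, he⟩
    obtain ⟨-, u', v', rfl, h'⟩ := hstep hx he
    refine ⟨u', ⟨v', h', ?_⟩, rfl⟩
    rw [← he, lagrValue_theta_iterate k (straight_pos (hpos h')), lagrValue_straight (hpos h')]
  · rintro x ⟨y, hx, -⟩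
    have h1 := hx.1.left
    have h2 := hx.1.left_lt
    rw [abs_le]; constructor <;> linarith

lemma IsTurn.isClassified {u v : ℝ} (h : IsTurn u v) : IsClassified (lagrValue u) := by
  rcases h.exists_isTurn with h' | h' | ⟨k, u', hk, rfl, h'⟩
  · exact Or.inl h'
  · exact Or.inr (Or.inl h')
  · have hu' : 0 < u' := by linarith [h'.left]
    rw [lagrValue_theta_iterate k (straight_pos hu'), lagrValue_straight hu']
    exact IsTurnAfter.isClassified hk ⟨h', v, h.right, h.right_lt, rfl⟩

lemma IsGood.isClassified_of_lt {t v : ℝ} (ht : 0 < t) (h : IsGood t v) (hv : 2 / 3 < v) :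
    IsClassified (lagrValue t) := by
  rcases h.exists_isTurn ht hv with h1 | h1 | ⟨i, u, rfl, h1⟩
  · exact Or.inl (by rw [h1])
  · exact Or.inr (Or.inl h1)
  · have hu : 0 < u := by linarith [h1.left]
    rw [lagrValue_theta_iterate i (straight_pos hu), lagrValue_straight hu]
    exact h1.isClassified

lemma IsGood.isClassified_of_theta {t v : ℝ} (ht : 2 / 3 < t) (hv : 0 < v) (h : IsGood t v) :
    IsClassified (lagrValue t) := by
  obtain ⟨x, hx, rfl⟩ := exists_eq_theta ht (h.lt_one (by linarith) hv)
  rw [lagrValue_theta hx]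
  exact IsGood.isClassified_of_lt hx (GoodFrom.theta hx hv h) (two_thirds_lt_theta hv)

lemma IsGood.isClassified_of_mem {t v : ℝ} (ht : 0 < t) (h : IsGood t v) (h1 : 1 / 2 < v)
    (h2 : v < 2 / 3) : IsClassified (lagrValue t) := by
  have big : ∀ {t v : ℝ}, 0 < t → IsGood t v → 4 / 7 ≤ v → v < 2 / 3 →
      IsClassified (lagrValue t) := by
    intro t v ht h h1 h2
    have hv : 0 < v := by linarith
    rcases lt_or_gt_of_ne (h.ne_two_thirds ht hv) with h3 | h3
    · obtain ⟨x, hx, rfl⟩ := exists_eq_straight (h.half_lt ht hv h1) h3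
      have m := straight_mem (v := v) (by linarith) h2.le
      rw [lagrValue_straight hx, IsGood.eq_inv_sqrt_three hx (GoodFrom.straight hx hv h) m.1 m.2]
      exact Or.inr (Or.inl rfl)
    · exact h.isClassified_of_theta h3 hv
  rcases le_or_gt (4 / 7) v with h3 | h3
  · exact big ht h h3 h2
  · have hv : 0 < v := by linarith
    rw [← lagrValue_mirror ht]
    exact big (by positivity) (h.mirror ht hv)
      (by rw [le_div_iff₀ (by positivity)]; linarith)
      (by rw [div_lt_iff₀ (by positivity)]; linarith)

lemma IsGood.isClassified {t v : ℝ} (ht : 0 < t) (hv : 0 < v) (h : IsGood t v) :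
    IsClassified (lagrValue t) := by
  rcases lt_or_gt_of_ne (h.ne_half ht hv) with h1 | h1
  · rw [← lagrValue_mirror ht]
    exact (h.mirror ht hv).isClassified_of_theta (by rw [lt_div_iff₀ (by positivity)]; linarith)
      (by positivity)
  · rcases lt_or_gt_of_ne (h.ne_two_thirds ht hv) with h2 | h2
    · obtain ⟨x, hx, rfl⟩ := exists_eq_straight h1 h2
      rw [lagrValue_straight hx]
      exact IsGood.isClassified_of_mem hx (GoodFrom.straight hx hv h) (half_lt_straight hv)
        (straight_lt_two_thirds hv)
    · exact h.isClassified_of_theta h2 hv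

lemma isClassified_lagrValue {t : ℝ} (ht : 0 < t)
    (h : ENNReal.ofReal (Real.sqrt 3 / 4) < lagrValue t) : IsClassified (lagrValue t) := by
  obtain ⟨t', v', h1, h2, e, g⟩ := exists_goodFrom_zero_of_lt (c := 1 / 4) ht (by norm_num)
    (by convert h using 2; ring)
  rw [← e]
  exact IsGood.isClassified h1 h2 g

/-! ### Good states from conditions at the edges -/

lemma le_formVal_of_le_sub {τ ν c e : ℝ} (hA : 0 < τ * ν + 1) {p q : ℕ} (hν : 0 ≤ ν) (he : e ≤ p - τ * q)
    (h : c * (τ * ν + 1) ≤ e * (ν * p + q)) : c ≤ formVal τ ν p q := by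
  rw [formVal, le_div_iff₀ hA]
  exact h.trans (mul_le_mul_of_nonneg_right (he.trans (le_abs_self _)) (by positivity))

lemma le_formVal_of_sub_le {τ ν c e : ℝ} (hA : 0 < τ * ν + 1) {p q : ℕ} (hν : 0 ≤ ν) (he : e ≤ τ * q - p)
    (h : c * (τ * ν + 1) ≤ e * (ν * p + q)) : c ≤ formVal τ ν p q := by
  rw [formVal, le_div_iff₀ hA, abs_sub_comm]
  exact h.trans (mul_le_mul_of_nonneg_right (he.trans (le_abs_self _)) (by positivity))

/-- The conditions at the two vertices of the edge crossed in the state `(t, v)`. -/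
structure LowAtEdge (c t v : ℝ) : Prop where
  pos_left : 0 < t
  left_lt : t < 1
  pos_right : 0 < v
  right_le : v ≤ 1
  inf : c * (3 * t * v + 1) ≤ v
  zero : c * (3 * t * v + 1) ≤ t

/-- Serves points with p, q ≥ 1 on the first lattice: when the linear factor is at least 1/3, their
value is at least that of the right-hand side. -/
lemma LowAtEdge.mul_le {c t v : ℝ} (h : LowAtEdge c t v) (hc : c ≤ 1 / 3) :
    c * (3 * t * v + 1) ≤ 1 / 3 * (3 * v + 1) := by
  have := mul_pos h.pos_left h.pos_right
  have h1 := mul_le_mul_of_nonneg_right h.left_lt.le h.pos_right.le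
  have h2 := mul_le_mul_of_nonneg_right hc (by linarith : 0 ≤ 3 * t * v + 1)
  linarith

lemma one_le_cast {n : ℕ} (h : 0 < n) : (1 : ℝ) ≤ n := by exact_mod_cast h

/-- Outside of the next cone of a `theta` move, values are bounded below by those at the edge. -/
lemma LowAtEdge.left_of_theta {c t v : ℝ} (h : LowAtEdge c t v) (hc : c ≤ 1 / 3) (ht : 2 / 3 < t)
    {p q : ℕ} (h0 : 0 < p + q) (hpq : q < p ∨ 3 * p < 2 * q) : c ≤ formVal t (3 * v) p q := by
  have hA : 0 < t * (3 * v) + 1 := by have := h.pos_left; have := h.pos_right; positivity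
  have hm := h.mul_le hc
  have hv := h.pos_right
  have ht1 := h.left_lt
  have e0 : t * (3 * v) + 1 = 3 * t * v + 1 := by ring
  have q0 : (0 : ℝ) ≤ q := Nat.cast_nonneg q
  rcases hpq with h1 | h1
  · have h1' : (q : ℝ) + 1 ≤ p := by exact_mod_cast h1
    apply le_formVal_of_le_sub (e := 1) hA (by positivity) (by nlinarith)
    rw [e0]
    nlinarith [h.inf]
  · have h1' : 3 * (p : ℝ) + 1 ≤ 2 * q := by exact_mod_cast h1
    rcases Nat.eq_zero_or_pos p with rfl | hp
    · have hq := one_le_cast (n := q) (by omega)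
      apply le_formVal_of_sub_le (e := t) hA (by positivity) (by push_cast; nlinarith)
      rw [e0]
      push_cast
      nlinarith [h.zero]
    · have hp := one_le_cast hp
      apply le_formVal_of_sub_le (e := 1 / 3) hA (by positivity) (by nlinarith)
      rw [e0]
      nlinarith

lemma LowAtEdge.right_of_theta {c t v : ℝ} (h : LowAtEdge c t v) (ht : 2 / 3 < t)
    {p q : ℕ} (h0 : 0 < p + q) (hpq : 3 * q < p ∨ p < 2 * q) : c ≤ formVal (3 * t) v p q := by
  have hA : 0 < 3 * t * v + 1 := by have := h.pos_left; have := h.pos_right; positivity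
  have hv := h.pos_right
  have ht1 := h.left_lt
  have q0 : (0 : ℝ) ≤ q := Nat.cast_nonneg q
  have p0 : (0 : ℝ) ≤ p := Nat.cast_nonneg p
  rcases hpq with h1 | h1
  · have h1' : 3 * (q : ℝ) + 1 ≤ p := by exact_mod_cast h1
    apply le_formVal_of_le_sub (e := 1) hA hv.le (by nlinarith)
    nlinarith [h.inf]
  · have h1' : (p : ℝ) + 1 ≤ 2 * q := by exact_mod_cast h1
    have hq := one_le_cast (n := q) (by omega)
    apply le_formVal_of_sub_le (e := 1) hA hv.le (by nlinarith)
    nlinarith [h.zero]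

lemma LowAtEdge.left_of_straight {c t v : ℝ} (h : LowAtEdge c t v) (hc : c ≤ 1 / 3)
    (ht : 1 / 2 < t) (ht' : t < 2 / 3) {p q : ℕ} (h0 : 0 < p + q)
    (hpq : 2 * q < 3 * p ∨ 2 * p < q) : c ≤ formVal t (3 * v) p q := by
  have hA : 0 < t * (3 * v) + 1 := by have := h.pos_left; have := h.pos_right; positivity
  have hm := h.mul_le hc
  have hv := h.pos_right
  have e0 : t * (3 * v) + 1 = 3 * t * v + 1 := by ring
  have q0 : (0 : ℝ) ≤ q := Nat.cast_nonneg q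
  rcases hpq with h1 | h1
  · have h1' : 2 * (q : ℝ) + 1 ≤ 3 * p := by exact_mod_cast h1
    have hp := one_le_cast (n := p) (by omega)
    rcases Nat.eq_zero_or_pos q with rfl | hq
    · apply le_formVal_of_le_sub (e := 1) hA (by positivity) (by push_cast; linarith)
      rw [e0]
      push_cast
      nlinarith [h.inf]
    · have hq := one_le_cast hq
      apply le_formVal_of_le_sub (e := 1 / 3) hA (by positivity) (by nlinarith)
      rw [e0]
      nlinarith
  · have h1' : 2 * (p : ℝ) + 1 ≤ q := by exact_mod_cast h1
    have hq := one_le_cast (n := q) (by omega)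
    rcases Nat.eq_zero_or_pos p with rfl | hp
    · apply le_formVal_of_sub_le (e := t) hA (by positivity) (by push_cast; nlinarith)
      rw [e0]
      push_cast
      nlinarith [h.zero]
    · have hp := one_le_cast hp
      apply le_formVal_of_sub_le (e := 1 / 3) hA (by positivity) (by nlinarith)
      rw [e0]
      nlinarith

lemma LowAtEdge.right_of_straight {c t v : ℝ} (h : LowAtEdge c t v) (hc : c ≤ 1 / 3)
    (ht : 1 / 2 < t) (ht' : t < 2 / 3) {p q : ℕ} (h0 : 0 < p + q)
    (hpq : 2 * q < p ∨ 2 * p < 3 * q) : c ≤ formVal (3 * t) v p q := by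
  have hA : 0 < 3 * t * v + 1 := by have := h.pos_left; have := h.pos_right; positivity
  have hv := h.pos_right
  have hv1 := h.right_le
  have q0 : (0 : ℝ) ≤ q := Nat.cast_nonneg q
  have p0 : (0 : ℝ) ≤ p := Nat.cast_nonneg p
  rcases hpq with h1 | h1
  · have h1' : 2 * (q : ℝ) + 1 ≤ p := by exact_mod_cast h1
    apply le_formVal_of_le_sub (e := 1) hA hv.le (by nlinarith)
    nlinarith [h.inf]
  · have h1' : 2 * (p : ℝ) + 1 ≤ 3 * q := by exact_mod_cast h1
    have hq := one_le_cast (n := q) (by omega)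
    rcases Nat.eq_zero_or_pos p with rfl | hp
    · apply le_formVal_of_sub_le (e := 1) hA hv.le (by push_cast; nlinarith)
      push_cast
      nlinarith [h.zero]
    · have hp := one_le_cast hp
      apply le_formVal_of_sub_le (e := 1 / 2) hA hv.le (by nlinarith)
      have e1 : c * (3 * t * v + 1) ≤ 1 / 3 * (2 * v + 1) := by
        have := mul_le_mul_of_nonneg_right hc hA.le
        have := mul_le_mul_of_nonneg_right ht'.le hv.le
        linarith
      nlinarith

/-- A set of states that is closed under the coding and satisfies the conditions at the edges
satisfies them at all lattice points. -/
lemma goodFrom_zero_of_closed {c : ℝ} (hc : c ≤ 1 / 3) {S : Set (ℝ × ℝ)}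
    (hS : ∀ s ∈ S, LowAtEdge c s.1 s.2)
    (hstep : ∀ s ∈ S, ∃ x, 0 < x ∧ (s.1 = theta x ∧ (x, theta s.2) ∈ S ∨
      s.1 = straight x ∧ (x, straight s.2) ∈ S)) :
    ∀ s ∈ S, GoodFrom s.1 s.2 c 0 := by
  -- Strong induction on p + q: a point in the cone spanned by the columns of the next move is the
  -- image of a smaller point for the next state; a point outside the cone is controlled by the
  -- conditions at the edge.
  have main : ∀ n : ℕ, ∀ s ∈ S, ∀ p q : ℕ, 0 < p + q → p + q = n →
      c ≤ formVal s.1 (3 * s.2) p q ∧ c ≤ formVal (3 * s.1) s.2 p q := by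
    intro n
    induction n using Nat.strong_induction_on with
    | _ n ih =>
      rintro ⟨t, v⟩ hs p q h0 hn
      have hl := hS _ hs
      obtain ⟨x, hx, ⟨h1, h2⟩ | ⟨h1, h2⟩⟩ := hstep _ hs
      all_goals
        dsimp only at hl h1 h2 ⊢
        subst h1
      · have hv := hl.pos_right
        constructor
        · by_cases hq : q < p ∨ 3 * p < 2 * q
          · exact hl.left_of_theta hc (two_thirds_lt_theta hx) h0 hq
          · push Not at hq
            obtain ⟨p', rfl⟩ : ∃ p', q = p + p' := ⟨q - p, by omega⟩
            obtain ⟨q', hq'⟩ : ∃ q', 3 * p = 2 * (p + p') + q' := ⟨3 * p - 2 * (p + p'), by omega⟩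
            have key := (ih (p' + q') (by omega) _ h2 p' q' (by omega) rfl).1
            have e := formVal_mobius (a := 2) (b := 1) (c := 3) (d := 1) (τ := x) (ν := 3 * v)
              (by norm_num) (by push_cast; positivity) (by push_cast; positivity) p' q'
            rw [show 2 * p' + 1 * q' = p by omega, show 3 * p' + 1 * q' = p + p' by omega] at e
            convert key using 1
            convert e using 2
            · unfold theta; push_cast; ring
            · unfold theta; push_cast; field_simp; ring
        · by_cases hq : 3 * q < p ∨ p < 2 * q
          · exact hl.right_of_theta (two_thirds_lt_theta hx) h0 hq
          · push Not at hq
            obtain ⟨q', rfl⟩ : ∃ q', p = 2 * q + q' := ⟨p - 2 * q, by omega⟩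
            obtain ⟨p', rfl⟩ : ∃ p', q = q' + p' := ⟨q - q', by omega⟩
            have key := (ih (p' + q') (by omega) _ h2 p' q' (by omega) rfl).2
            have e := formVal_mobius (a := 2) (b := 3) (c := 1) (d := 1) (τ := 3 * x) (ν := v)
              (by norm_num) (by push_cast; positivity) (by push_cast; positivity) p' q'
            rw [show 2 * p' + 3 * q' = 2 * (q' + p') + q' by ring,
              show 1 * p' + 1 * q' = q' + p' by ring] at e
            convert key using 1
            convert e using 2
            · unfold theta; push_cast; field_simp
            · unfold theta; push_cast; congr 1 <;> ring
      · have hv := hl.pos_right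
        constructor
        · by_cases hq : 2 * q < 3 * p ∨ 2 * p < q
          · exact hl.left_of_straight hc (half_lt_straight hx) (straight_lt_two_thirds hx) h0 hq
          · push Not at hq
            obtain ⟨p', hp'⟩ : ∃ p', 2 * p = q + p' := ⟨2 * p - q, by omega⟩
            obtain ⟨q', hq'⟩ : ∃ q', 2 * q = 3 * p + q' := ⟨2 * q - 3 * p, by omega⟩
            have key := (ih (p' + q') (by omega) _ h2 p' q' (by omega) rfl).1
            have e := formVal_mobius (a := 2) (b := 1) (c := 3) (d := 2) (τ := x) (ν := 3 * v)
              (by norm_num) (by push_cast; positivity) (by push_cast; positivity) p' q'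
            rw [show 2 * p' + 1 * q' = p by omega, show 3 * p' + 2 * q' = q by omega] at e
            convert key using 1
            convert e using 2
            · unfold straight; push_cast; ring
            · unfold straight; push_cast; field_simp; ring
        · by_cases hq : 2 * q < p ∨ 2 * p < 3 * q
          · exact hl.right_of_straight hc (half_lt_straight hx) (straight_lt_two_thirds hx) h0 hq
          · push Not at hq
            obtain ⟨p', hp'⟩ : ∃ p', 2 * p = 3 * q + p' := ⟨2 * p - 3 * q, by omega⟩
            obtain ⟨q', hq'⟩ : ∃ q', 2 * q = p + q' := ⟨2 * q - p, by omega⟩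
            have key := (ih (p' + q') (by omega) _ h2 p' q' (by omega) rfl).2
            have e := formVal_mobius (a := 2) (b := 3) (c := 1) (d := 2) (τ := 3 * x) (ν := v)
              (by norm_num) (by push_cast; positivity) (by push_cast; positivity) p' q'
            rw [show 2 * p' + 3 * q' = p by omega, show 1 * p' + 2 * q' = q by omega] at e
            convert key using 1
            convert e using 2
            · unfold straight; push_cast; field_simp
            · unfold straight; push_cast; congr 1 <;> ring
  exact fun s hs p q h0 _ => main _ s hs p q h0 rfl

/-! ### Values of the periodic codings -/

/-- The height at the turn of the periodic coding with fixed point `w`. -/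
noncomputable def turnHeight (w : ℝ) : ℝ := 3 * w + 1 / straight w

lemma theta_mem {x : ℝ} (h1 : 7 / 12 ≤ x) (h2 : x ≤ 4 / 5) : 3 / 4 ≤ theta x ∧ theta x ≤ 4 / 5 := by
  unfold theta
  constructor
  · rw [le_div_iff₀ (by linarith)]; linarith
  · rw [div_le_iff₀ (by linarith)]; linarith

lemma straight_mem_of_lt {w : ℝ} (h1 : 2 / 3 < w) (h2 : w < 1) :
    7 / 12 ≤ straight w ∧ straight w ≤ 3 / 5 := by
  unfold straight
  constructor
  · rw [le_div_iff₀ (by linarith)]; linarith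
  · rw [div_le_iff₀ (by linarith)]; linarith

lemma theta_iterate_mem_of_straight {w : ℝ} (h1 : 2 / 3 < w) (h2 : w < 1) (i : ℕ) :
    3 / 4 ≤ theta^[i + 1] (straight w) ∧ theta^[i + 1] (straight w) ≤ 4 / 5 := by
  have hs := straight_mem_of_lt h1 h2
  induction i with
  | zero => exact theta_mem hs.1 (by linarith)
  | succ i ih =>
    rw [Function.iterate_succ_apply']
    exact theta_mem (le_trans (by norm_num) ih.1) ih.2

lemma fixed_mem {k : ℕ} (hk : 1 ≤ k) {w : ℝ} (hw : 0 < w) (hfix : theta^[k] (straight w) = w) :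
    3 / 4 ≤ w ∧ w ≤ 4 / 5 := by
  have h := theta_iterate_mem hk (straight_pos hw)
  rw [hfix] at h
  obtain ⟨j, rfl⟩ : ∃ j, k = j + 1 := ⟨k - 1, by omega⟩
  have := theta_iterate_mem_of_straight h.1 h.2 j
  rwa [hfix] at this

lemma turnHeight_ge {w : ℝ} (h1 : 3 / 4 ≤ w) (h2 : w ≤ 4 / 5) : 3.9 ≤ turnHeight w := by
  have hs := straight_mem_of_lt (w := w) (by linarith) (by linarith)
  have : 5 / 3 ≤ 1 / straight w := by
    rw [le_div_iff₀ (by linarith)]; linarith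
  unfold turnHeight
  linarith

lemma turnHeight_mul_straight {w : ℝ} (hw : 0 < w) :
    turnHeight w * straight w = 3 * w * straight w + 1 := by
  have := (straight_pos hw).ne'
  unfold turnHeight
  field_simp

lemma ofReal_le_lagrValue_fixed {k : ℕ} (hk : 1 ≤ k) {w : ℝ} (hw : 0 < w)
    (hfix : theta^[k] (straight w) = w) :
    ENNReal.ofReal (Real.sqrt 3 * (1 / turnHeight w)) ≤ lagrValue w := by
  obtain ⟨hw1, hw2⟩ := fixed_mem hk hw hfix
  have hH := turnHeight_ge hw1 hw2
  have hH0 : 0 < turnHeight w := by linarith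
  have hs := straight_mem_of_lt (w := w) (by linarith) (by linarith)
  have hs0 := straight_pos hw
  have hmul := turnHeight_mul_straight hw
  set s := straight w with hsdef
  have hbd : ∀ i, 7 / 12 ≤ theta^[i] s ∧ theta^[i] s ≤ 4 / 5 := by
    intro i
    rcases i with _ | i
    · exact ⟨hs.1, by linarith [hs.2, show theta^[0] s = s from rfl]⟩
    · have := theta_iterate_mem_of_straight (w := w) (by linarith) (by linarith) i
      rw [← hsdef] at this
      exact ⟨by linarith, this.2⟩
  have hb1 : ∀ i, 3 / 4 ≤ theta^[i + 1] s := fun i =>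
    (theta_iterate_mem_of_straight (w := w) (by linarith) (by linarith) i).1
  -- These are the states along one period: i `theta` moves remain before the next `straight` move,
  -- and j have been made since the last one.
  have key := goodFrom_zero_of_closed (c := 1 / turnHeight w)
    (S := {x | ∃ i j, i + j = k ∧ x = (theta^[i] s, theta^[j] s)})
    (by rw [div_le_div_iff₀ hH0 (by norm_num)]; linarith) ?_ ?_ (theta^[k] s, s) ⟨k, 0, rfl, rfl⟩
  · rw [hfix] at key
    exact ofReal_sqrt_mul_le_of_forall fun c' h0 hc =>
      ofReal_le_lagrValue (key.lagrPair hw hs0 h0 hc)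
  · rintro _ ⟨i, j, hij, rfl⟩
    have bi := hbd i
    have bj := hbd j
    -- The height `turnHeight w` occurs only next to the `straight` move, at j = 0 or i = 0.
    -- Elsewhere the height is at most 3 · 4/5 + 4/3, which is below 3.9.
    refine ⟨by linarith, by linarith, by linarith, by linarith, ?_, ?_⟩ <;>
      rw [one_div, inv_mul_le_iff₀ hH0]
    · rcases j with _ | j
      · rw [show i = k by omega, hfix]
        exact hmul.ge
      · have := hb1 j
        dsimp only
        nlinarith
    · rcases i with _ | i
      · rw [show j = k by omega, hfix]
        dsimp only [Function.iterate_zero, id]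
        linarith
      · have := hb1 i
        dsimp only
        nlinarith
  · rintro _ ⟨i, j, hij, rfl⟩
    rcases i with _ | i
    · refine ⟨w, hw, Or.inr ⟨hsdef, k, 0, by omega, ?_⟩⟩
      rw [show j = k by omega, hfix]
      rfl
    · exact ⟨theta^[i] s, theta_iterate_pos i hs0, Or.inl ⟨Function.iterate_succ_apply' _ _ _,
        i, j + 1, by omega, by rw [Function.iterate_succ_apply' theta j]⟩⟩

lemma goodFrom_theta_iterate {c : ℝ} {K : ℕ} (j : ℕ) : ∀ {x y : ℝ}, 0 < x → 0 < y →
    GoodFrom (theta^[j] x) y c K → GoodFrom x (theta^[j] y) c K := by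
  induction j with
  | zero => exact fun _ _ h => h
  | succ j ih =>
    intro x y hx hy h
    rw [Function.iterate_succ_apply'] at h
    rw [Function.iterate_succ_apply]
    exact ih hx (theta_pos hy)
      ((GoodFrom.theta (theta_iterate_pos j hx) hy h).mono (Nat.sub_le _ _))

/-- For the upper bound, one tour of the cycle returns to the same state with fewer exceptional
points, so there are none; the condition at infinity then bounds the constant by 1/`turnHeight w`.
-/
lemma lagrValue_fixed {k : ℕ} (hk : 1 ≤ k) {w : ℝ} (hw : 0 < w)
    (hfix : theta^[k] (straight w) = w) :
    lagrValue w = ENNReal.ofReal (Real.sqrt 3 * (1 / turnHeight w)) := by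
  refine le_antisymm (lagrValue_le fun c c' h0 hc hp => ?_) (ofReal_le_lagrValue_fixed hk hw hfix)
  have hs := straight_pos hw
  have hH0 : 0 < turnHeight w := by unfold turnHeight; positivity
  obtain ⟨K, hK⟩ := hp.exists_goodFrom hw hs h0 hc
  have hcycle : GoodFrom w (straight w) c' 0 := by
    induction K with
    | zero => exact hK
    | succ K ih =>
      apply ih
      have h1 : GoodFrom (theta^[k] (straight w)) (straight w) c' (K + 1) := by rwa [hfix]
      have h2 := goodFrom_theta_iterate k hs hs h1
      rw [hfix] at h2
      exact GoodFrom.straight hw hw h2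
  have := hcycle.height_inf hw hs
  apply ENNReal.ofReal_le_ofReal
  apply mul_le_mul_of_nonneg_left _ sqrt_three_pos.le
  rw [le_div_iff₀ hH0]
  exact this

/-- For even `k` the coordinate of `w` is positive, so `w < thetaFix`; and the height 3w + (3w +
2)/(2w + 1) is below 4 exactly when 3w² < w + 1, for w > 0. -/
lemma turnHeight_lt_four {k : ℕ} (hk : 1 ≤ k) (hke : Even k) {w : ℝ} (hw : 0 < w)
    (hfix : theta^[k] (straight w) = w) : turnHeight w < 4 := by
  obtain ⟨hw1, hw2⟩ := fixed_mem hk hw hfix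
  have hc := thetaCoord_straight_mem (x := w) (by linarith) (by linarith)
  have e := thetaCoord_iterate k (straight_pos hw)
  rw [hfix] at e
  have hr : thetaMult ≠ 0 := by linarith [thetaMult_mem.2]
  have hpos : 0 < thetaCoord w := by
    rw [e]
    exact mul_pos (hke.pow_pos hr) (by linarith)
  have hb := thetaConj_neg
  unfold thetaCoord at hpos
  have hlt : w < thetaFix := by
    have := (div_pos_iff_of_pos_right (by linarith : 0 < w - thetaConj)).1 hpos
    linarith
  have hsq := thetaFix_sq
  have hs := straight_pos hw
  have e1 := turnHeight_mul_straight hw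
  have e2 := straight_mul hw
  have h3 : 3 * w * straight w + 1 < 4 * straight w := by
    have h4 : (3 * w * straight w + 1) * (3 * w + 2) < 4 * straight w * (3 * w + 2) := by
      have e3 : (3 * w * straight w + 1) * (3 * w + 2) = 3 * w * (2 * w + 1) + (3 * w + 2) := by
        rw [← e2]; ring
      have e4 : 4 * straight w * (3 * w + 2) = 4 * (2 * w + 1) := by rw [← e2]; ring
      rw [e3, e4]
      have h5 : 0 < (thetaFix - w) * (w - thetaConj) := mul_pos (by linarith) (by linarith)
      unfold thetaConj at h5
      nlinarith
    exact lt_of_mul_lt_mul_right h4 (by linarith)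
  rw [← e1] at h3
  exact lt_of_mul_lt_mul_right h3 hs.le

lemma fixed_unique {k : ℕ} {w w' : ℝ} (hw : 0 < w) (hw' : 0 < w')
    (hfix : theta^[k] (straight w) = w) (hfix' : theta^[k] (straight w') = w') : w = w' := by
  have h := (abs_theta_iterate_sub_le k (straight_pos hw) (straight_pos hw')).trans
    (abs_straight_sub_le hw hw')
  rw [hfix, hfix'] at h
  have h0 : |w - w'| ≤ 0 := by linarith
  exact sub_eq_zero.1 (abs_eq_zero.1 (le_antisymm h0 (abs_nonneg _)))

lemma abs_theta_iterate_sub_thetaFix_le (k : ℕ) {x : ℝ} (hx : 0 < x) :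
    |theta^[k] x - thetaFix| ≤ |x - thetaFix| * (1 / 2) ^ k := by
  induction k with
  | zero => simp
  | succ k ih =>
    rw [Function.iterate_succ_apply', pow_succ]
    have := abs_theta_sub_thetaFix_le (theta_iterate_pos k hx)
    linarith

lemma turnHeight_thetaFix : turnHeight thetaFix = 4 := by
  have hsq := thetaFix_sq
  have h0 := thetaFix_pos
  unfold turnHeight straight
  field_simp
  linarith

lemma tendsto_fixed {w : ℕ → ℝ} (hw : ∀ k, 0 < w k)
    (hfix : ∀ k, theta^[k + 1] (straight (w k)) = w k) :
    Tendsto (fun k => Real.sqrt 3 * (1 / turnHeight (w k))) atTop (𝓝 (Real.sqrt 3 / 4)) := by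
  have h1 : Tendsto w atTop (𝓝 thetaFix) := by
    rw [tendsto_iff_norm_sub_tendsto_zero]
    have h2 : Tendsto (fun k : ℕ => (1 / 2 : ℝ) ^ (k + 1)) atTop (𝓝 0) :=
      (tendsto_pow_atTop_nhds_zero_of_lt_one (by norm_num) (by norm_num)).comp (tendsto_add_atTop_nat 1)
    refine squeeze_zero (fun _ => norm_nonneg _) (fun k => ?_) h2
    have h3 := abs_theta_iterate_sub_thetaFix_le (k + 1) (straight_pos (hw k))
    rw [hfix] at h3
    have h4 : |straight (w k) - thetaFix| ≤ 1 := by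
      have := straight_pos (hw k)
      have := straight_lt_two_thirds (hw k)
      have := thetaFix_gt
      have := thetaFix_lt
      rw [abs_le]; constructor <;> linarith
    exact h3.trans (mul_le_of_le_one_left (by positivity) h4)
  have hc : ContinuousAt (fun x => Real.sqrt 3 * (1 / turnHeight x)) thetaFix := by
    have h0 := thetaFix_pos
    have hs := straight_pos h0
    have hsc : ContinuousAt straight thetaFix := by
      unfold straight
      exact ContinuousAt.div (by fun_prop) (by fun_prop) (by positivity)
    have hh : ContinuousAt turnHeight thetaFix := by
      unfold turnHeight
      exact ContinuousAt.add (by fun_prop) (continuousAt_const.div hsc hs.ne')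
    exact continuousAt_const.mul (continuousAt_const.div hh (by rw [turnHeight_thetaFix]; norm_num))
  have := hc.tendsto.comp h1
  rw [turnHeight_thetaFix] at this
  rw [mul_one_div] at this
  exact this

/-! ### Parametrization of the Eisenstein pairs -/

lemma exists_mul_of_mul_eq_mul {a b x y : ℕ} (hxy : Nat.Coprime x y) (hx : 0 < x)
    (h : a * y = b * x) : ∃ r, a = r * x ∧ b = r * y := by
  have hdvd : x ∣ a := hxy.dvd_of_dvd_mul_right (h ▸ Dvd.intro_left b rfl)
  obtain ⟨r, rfl⟩ := hdvd
  refine ⟨r, mul_comm _ _, ?_⟩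
  apply Nat.eq_of_mul_eq_mul_right hx
  rw [← h]; ring

lemma coprime_of_intCast {x y : ℕ} (h : IsCoprime (x : ℤ) (y : ℤ)) : Nat.Coprime x y :=
  Nat.isCoprime_iff_coprime.1 h

lemma isEisensteinPair_left {p q : ℕ} (hp : 0 < p) (hq : 0 < q) :
    IsEisensteinPair (3 * p ^ 2 + 2 * p * q, 2 * p * q + q ^ 2) :=
  ⟨by positivity, by positivity, ⟨3 * p ^ 2 + 3 * p * q + q ^ 2, by ring⟩⟩

lemma isEisensteinPair_right {p q : ℕ} (hp : 0 < p) (hq : 0 < q) :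
    IsEisensteinPair (p ^ 2 + 2 * p * q, 2 * p * q + 3 * q ^ 2) :=
  ⟨by positivity, by positivity, ⟨p ^ 2 + 3 * p * q + 3 * q ^ 2, by ring⟩⟩

/-- The parametrization of Eisenstein pairs. -/
lemma IsEisensteinPair.exists_eq {a b : ℕ} (h : IsEisensteinPair (a, b)) :
    ∃ r p q : ℕ, 0 < r ∧ 0 < p ∧ 0 < q ∧
      ((a, b) = (r * (3 * p ^ 2 + 2 * p * q), r * (2 * p * q + q ^ 2)) ∨
        (a, b) = (r * (p ^ 2 + 2 * p * q), r * (2 * p * q + 3 * q ^ 2))) := by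
  obtain ⟨ha, hb, c, hc⟩ := h
  dsimp only at ha hb hc
  have hcb : b < c := by nlinarith
  obtain ⟨e, rfl⟩ : ∃ e, c = b + e := ⟨c - b, by omega⟩
  -- With c = b + e, the reduced fraction p/q = (a + e)/b is the rational parameter of the conic,
  -- and it determines the ratio a : b.
  obtain ⟨g, p, q, hg, hpq, hp', hq'⟩ := Nat.exists_coprime' (m := a + e) (n := b) (Nat.gcd_pos_of_pos_right _ hb)
  have hp : 0 < p := Nat.pos_of_ne_zero (by rintro rfl; omega)
  have hq : 0 < q := Nat.pos_of_ne_zero (by rintro rfl; omega)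
  have key : a * (q * (2 * p + 3 * q)) = b * (p * (p + 2 * q)) := by
    have h1 : a * (b * (2 * (a + e) + 3 * b)) = b * ((a + e) * ((a + e) + 2 * b)) := by
      nlinarith
    apply Nat.eq_of_mul_eq_mul_right (Nat.mul_pos hg hg)
    have e1 : a * (q * (2 * p + 3 * q)) * (g * g) = a * ((q * g) * (2 * (p * g) + 3 * (q * g))) := by
      ring
    have e2 : b * (p * (p + 2 * q)) * (g * g) = b * ((p * g) * ((p * g) + 2 * (q * g))) := by ring
    rw [e1, e2, ← hp', ← hq', h1]
  obtain ⟨x, y, hxy⟩ := Nat.isCoprime_iff_coprime.2 hpq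
  have hr : ∀ {r X : ℕ}, a = r * X → 0 < r := fun {r X} h =>
    Nat.pos_of_ne_zero (by rintro rfl; simp at h; omega)
  -- The two sides p(p + 2q) and q(2p + 3q) can share only the factor 3. When 3 divides p it is
  -- cancelled, which produces the first family.
  by_cases h3 : 3 ∣ p
  · obtain ⟨p, rfl⟩ := h3
    have hp1 : 0 < p := by omega
    push_cast at hxy
    have h3q : IsCoprime (3 : ℤ) q := ⟨x * p, y, by linear_combination hxy⟩
    have cop : Nat.Coprime (p * (3 * p + 2 * q)) (q * (2 * p + q)) := by
      apply coprime_of_intCast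
      push_cast
      have c1 : IsCoprime (p : ℤ) q := ⟨3 * x, y, by linear_combination hxy⟩
      have c2 : IsCoprime (p : ℤ) (2 * p + q) := ⟨3 * x - 2 * y, y, by linear_combination hxy⟩
      have c3 : IsCoprime (3 * p + 2 * q : ℤ) q := ⟨x, y - 2 * x, by linear_combination hxy⟩
      have c4 : IsCoprime (3 * p + 2 * q : ℤ) (2 * p + q) :=
        ⟨2 * y - 3 * x, 6 * x - 3 * y, by linear_combination hxy⟩
      exact IsCoprime.mul_left (IsCoprime.mul_right c1 c2) (IsCoprime.mul_right c3 c4)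
    obtain ⟨r, h1, h2⟩ := exists_mul_of_mul_eq_mul (a := a) (b := b) cop (by positivity) (by
      apply Nat.eq_of_mul_eq_mul_left (show 0 < 3 by norm_num)
      linear_combination key)
    refine ⟨r, p, q, hr h1, hp1, hq, Or.inl ?_⟩
    rw [h1, h2]
    ext <;> ring
  · have h3p : IsCoprime (p : ℤ) 3 :=
      Nat.isCoprime_iff_coprime.2 ((Nat.Prime.coprime_iff_not_dvd Nat.prime_three).2 h3).symm
    have cop : Nat.Coprime (p * (p + 2 * q)) (q * (2 * p + 3 * q)) := by
      apply coprime_of_intCast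
      push_cast
      have c1 : IsCoprime (p : ℤ) q := ⟨x, y, hxy⟩
      have c2 : IsCoprime (p : ℤ) (2 * p + 3 * q) := by
        obtain ⟨X, Y, hXY⟩ := IsCoprime.mul_right h3p c1
        exact ⟨X - 2 * Y, Y, by linear_combination hXY⟩
      have c3 : IsCoprime (p + 2 * q : ℤ) q := ⟨x, y - 2 * x, by linear_combination hxy⟩
      have c4 : IsCoprime (p + 2 * q : ℤ) (2 * p + 3 * q) :=
        ⟨2 * y - 3 * x, 2 * x - y, by linear_combination hxy⟩
      exact IsCoprime.mul_left (IsCoprime.mul_right c1 c2) (IsCoprime.mul_right c3 c4)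
    obtain ⟨r, h1, h2⟩ := exists_mul_of_mul_eq_mul (a := a) (b := b) cop (by positivity) key
    refine ⟨r, p, q, hr h1, hp, hq, Or.inr ?_⟩
    rw [h1, h2]
    ext <;> ring

/-- For fixed `b` there are only finitely many Eisenstein pairs `(a, b)`. -/
lemma IsEisensteinPair.two_mul_le {a b : ℕ} (h : IsEisensteinPair (a, b)) : 2 * a ≤ 3 * b ^ 2 := by
  obtain ⟨ha, hb, c, hc⟩ := h
  dsimp only at ha hb hc
  have h1 : 2 * a + b < 2 * c := by nlinarith
  nlinarith

lemma IsEisensteinPair.swap {a b : ℕ} (h : IsEisensteinPair (a, b)) : IsEisensteinPair (b, a) := by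
  obtain ⟨ha, hb, c, hc⟩ := h
  exact ⟨hb, ha, c, by dsimp only at hc ⊢; rw [← hc]; ring⟩

/-! ### Distances to half-lines and identification of δ -/

/-- The complex number with coordinates `a`, `b` in the basis `1`, `ω`. -/
noncomputable def eisensteinCoord (a b : ℝ) : ℂ := (a : ℂ) + (b : ℂ) * eisensteinOmega

lemma eisensteinCoord_re (a b : ℝ) : (eisensteinCoord a b).re = a + b / 2 := by
  simp [eisensteinCoord, eisensteinOmega, Complex.add_re, Complex.mul_re]
  ring

lemma eisensteinCoord_im (a b : ℝ) : (eisensteinCoord a b).im = b * Real.sqrt 3 / 2 := by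
  simp [eisensteinCoord, eisensteinOmega, Complex.add_im, Complex.mul_im]
  ring

lemma norm_eisensteinCoord (a b : ℝ) :
    ‖eisensteinCoord a b‖ = Real.sqrt (a ^ 2 + a * b + b ^ 2) := by
  rw [Complex.norm_def, Complex.normSq_apply, eisensteinCoord_re, eisensteinCoord_im]
  congr 1
  have : Real.sqrt 3 * Real.sqrt 3 = 3 := Real.mul_self_sqrt (by norm_num)
  linear_combination (b ^ 2 / 4) * this

lemma exists_eq_eisensteinCoord (z : ℂ) : ∃ a b, z = eisensteinCoord a b := by
  have h3 := sqrt_three_pos.ne'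
  refine ⟨z.re - z.im / Real.sqrt 3, 2 * z.im / Real.sqrt 3, ?_⟩
  apply Complex.ext
  · rw [eisensteinCoord_re]; ring
  · rw [eisensteinCoord_im]; field_simp

lemma eisensteinPoint_eq (p : ℕ × ℕ) : eisensteinPoint p = eisensteinCoord p.1 p.2 := by
  simp [eisensteinPoint, eisensteinCoord]

lemma edist_eisensteinPoint (p : ℕ × ℕ) (α β τ : ℝ) :
    edist (eisensteinPoint p) ((τ : ℂ) * eisensteinCoord α β) =
      ENNReal.ofReal (Real.sqrt ((p.1 - τ * α) ^ 2 + (p.1 - τ * α) * (p.2 - τ * β)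
        + (p.2 - τ * β) ^ 2)) := by
  rw [edist_dist, dist_eq_norm, eisensteinPoint_eq, ← norm_eisensteinCoord]
  congr 2
  simp only [eisensteinCoord]
  push_cast
  ring

/-- The distance from a point of the open sector to a half-line of the open sector. -/
lemma rayDist_eq {α β : ℝ} (hα : 0 < α) (hβ : 0 < β) (h1 : α ^ 2 + α * β + β ^ 2 = 1)
    (p : ℕ × ℕ) :
    rayDist (eisensteinCoord α β) p =
      ENNReal.ofReal (Real.sqrt 3 / 2 * |p.1 * β - p.2 * α|) := by
  have e3 : Real.sqrt 3 ^ 2 = 3 := Real.sq_sqrt (by norm_num)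
  have eD : Real.sqrt 3 / 2 * |p.1 * β - p.2 * α|
      = Real.sqrt (3 / 4 * (p.1 * β - p.2 * α) ^ 2) := by
    rw [eq_comm, Real.sqrt_eq_iff_mul_self_eq (by positivity) (by positivity)]
    have := sq_abs (p.1 * β - p.2 * α)
    linear_combination (-(|p.1 * β - p.2 * α| ^ 2 / 4)) * e3 - (3 / 4) * this
  -- Completing the square in the ray parameter: the foot of the perpendicular has a nonnegative
  -- parameter because all coordinates are nonnegative, so it lies on the ray.
  have eN : ∀ τ : ℝ, (p.1 - τ * α) ^ 2 + (p.1 - τ * α) * (p.2 - τ * β) + (p.2 - τ * β) ^ 2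
      = (τ - (p.1 * α + p.2 * β + (p.1 * β + p.2 * α) / 2)) ^ 2
        + 3 / 4 * (p.1 * β - p.2 * α) ^ 2 := by
    intro τ
    linear_combination (τ ^ 2 - (p.1 : ℝ) ^ 2 - p.1 * p.2 - (p.2 : ℝ) ^ 2) * h1
  rw [eD]
  apply le_antisymm
  · have h0 : 0 ≤ p.1 * α + p.2 * β + (p.1 * β + p.2 * α) / 2 := by positivity
    refine (Metric.infEDist_le_edist_of_mem (show _ ∈ halfLine _ from ⟨_, h0, rfl⟩)).trans ?_
    rw [edist_eisensteinPoint, eN]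
    simp
  · refine Metric.le_infEDist.2 ?_
    rintro _ ⟨τ, -, rfl⟩
    rw [edist_eisensteinPoint, eN]
    apply ENNReal.ofReal_le_ofReal
    apply Real.sqrt_le_sqrt
    nlinarith [sq_nonneg (τ - (p.1 * α + p.2 * β + (p.1 * β + p.2 * α) / 2))]

lemma le_rayDist_of_nonpos {α β : ℝ} (h : α ≤ 0 ∨ β ≤ 0) {p : ℕ × ℕ} {m : ℕ} (h1 : 2 * m ≤ p.1)
    (h2 : 2 * m ≤ p.2) : (m : ENNReal) ≤ rayDist (eisensteinCoord α β) p := by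
  refine Metric.le_infEDist.2 ?_
  rintro _ ⟨τ, hτ, rfl⟩
  rw [edist_eisensteinPoint, ← ENNReal.ofReal_natCast]
  apply ENNReal.ofReal_le_ofReal
  apply Real.le_sqrt_of_sq_le
  have h1' : 2 * (m : ℝ) ≤ p.1 := by exact_mod_cast h1
  have h2' : 2 * (m : ℝ) ≤ p.2 := by exact_mod_cast h2
  have hm : (0 : ℝ) ≤ m := Nat.cast_nonneg m
  rcases h with h | h
  · have : 2 * (m : ℝ) ≤ p.1 - τ * α := by nlinarith
    nlinarith [sq_nonneg ((p.2 - τ * β) + (p.1 - τ * α) / 2)]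
  · have : 2 * (m : ℝ) ≤ p.2 - τ * β := by nlinarith
    nlinarith [sq_nonneg ((p.1 - τ * α) + (p.2 - τ * β) / 2)]

lemma norm_eisensteinPoint_le (p : ℕ × ℕ) : ‖eisensteinPoint p‖ ≤ p.1 + p.2 := by
  rw [eisensteinPoint_eq, norm_eisensteinCoord]
  apply Real.sqrt_le_iff.2 ⟨by positivity, ?_⟩
  have : (0 : ℝ) ≤ (p.1 : ℝ) * p.2 := by positivity
  nlinarith

lemma le_norm_eisensteinPoint (p : ℕ × ℕ) : (p.2 : ℝ) ≤ ‖eisensteinPoint p‖ := by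
  rw [eisensteinPoint_eq, norm_eisensteinCoord]
  apply Real.le_sqrt_of_sq_le
  have : (0 : ℝ) ≤ (p.1 : ℝ) * p.2 := by positivity
  nlinarith [sq_nonneg (p.1 : ℝ)]

lemma eventually_comap_iff {P : {p : ℕ × ℕ // IsEisensteinPair p} → Prop} :
    (∀ᶠ p in comap (fun p : {p : ℕ × ℕ // IsEisensteinPair p} => ‖eisensteinPoint p.1‖) atTop, P p)
      ↔ ∃ R : ℝ, ∀ p, R ≤ ‖eisensteinPoint p.1‖ → P p := by
  rw [eventually_comap, eventually_atTop]
  exact ⟨fun ⟨R, h⟩ => ⟨R, fun p hp => h _ hp p rfl⟩, fun ⟨R, h⟩ => ⟨R, fun b hb p e => h p (e ▸ hb)⟩⟩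

/-- Both coordinates of Eisenstein pairs tend to infinity, so the pairs move arbitrarily far from
the boundary rays of the sector and from any ray outside it. -/
lemma eisensteinDelta_eq_top {α β : ℝ} (h : α ≤ 0 ∨ β ≤ 0) :
    eisensteinDelta (eisensteinCoord α β) = ⊤ := by
  refine ENNReal.eq_top_of_forall_nnreal_le fun r => ?_
  obtain ⟨m, hm⟩ := exists_nat_ge r
  refine le_trans (b := (m : ENNReal)) (by exact_mod_cast hm) ?_
  refine le_liminf_of_le (by isBoundedDefault) ?_
  rw [eventually_comap_iff]
  refine ⟨(2 * m + 3 * (2 * m) ^ 2 : ℕ) + 1, ?_⟩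
  rintro ⟨⟨a, b⟩, hp⟩ hR
  have hn := hR.trans (norm_eisensteinPoint_le (a, b))
  have hn' : 2 * m + 3 * (2 * m) ^ 2 + 1 ≤ a + b := by exact_mod_cast hn
  have ha := hp.two_mul_le
  have hb := hp.swap.two_mul_le
  refine le_rayDist_of_nonpos h ?_ ?_
  · by_contra hcon
    push Not at hcon
    dsimp only at hcon
    have := Nat.pow_le_pow_left hcon.le 2
    omega
  · by_contra hcon
    push Not at hcon
    dsimp only at hcon
    have := Nat.pow_le_pow_left hcon.le 2
    omega

/-- The unit vector whose direction has parameter `t`. -/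
noncomputable def eisensteinDir (t : ℝ) : ℂ :=
  eisensteinCoord ((9 * t ^ 2 + 6 * t) / (9 * t ^ 2 + 9 * t + 3)) ((6 * t + 3) / (9 * t ^ 2 + 9 * t + 3))

lemma eisensteinDir_sq {t : ℝ} (ht : 0 < t) :
    ((9 * t ^ 2 + 6 * t) / (9 * t ^ 2 + 9 * t + 3)) ^ 2
      + (9 * t ^ 2 + 6 * t) / (9 * t ^ 2 + 9 * t + 3) * ((6 * t + 3) / (9 * t ^ 2 + 9 * t + 3))
      + ((6 * t + 3) / (9 * t ^ 2 + 9 * t + 3)) ^ 2 = 1 := by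
  have : 9 * t ^ 2 + 9 * t + 3 ≠ 0 := by positivity
  field_simp
  ring

lemma norm_eisensteinDir {t : ℝ} (ht : 0 < t) : ‖eisensteinDir t‖ = 1 := by
  rw [eisensteinDir, norm_eisensteinCoord, eisensteinDir_sq ht, Real.sqrt_one]

lemma exists_eq_eisensteinDir {α β : ℝ} (hα : 0 < α) (hβ : 0 < β)
    (h1 : α ^ 2 + α * β + β ^ 2 = 1) : ∃ t, 0 < t ∧ eisensteinCoord α β = eisensteinDir t := by
  have hβ1 : β < 1 := by nlinarith
  have h0 : 0 < 1 + α - β := by linarith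
  -- The conic parameter (a + c - b)/b, with c = 1, equals 3t.
  refine ⟨(1 + α - β) / (3 * β), by positivity, ?_⟩
  have e : 9 * ((1 + α - β) / (3 * β)) ^ 2 + 9 * ((1 + α - β) / (3 * β)) + 3
      = (2 + 2 * α + β) / β ^ 2 := by
    field_simp
    linear_combination 9 * h1
  unfold eisensteinDir
  rw [e]
  have hd : 0 < 2 + 2 * α + β := by positivity
  congr 1
  · rw [eq_div_iff (by positivity)]
    field_simp
    linear_combination 9 * h1
  · rw [eq_div_iff (by positivity)]
    field_simp
    ring

/-- Substituting the parametrization makes the distance a quadratic form in (p, q), with roots 3t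
and -1/`straight t`. The past `straight t` is thus the one for which distance and normalized form
agree exactly. -/
lemma rayDist_right {t : ℝ} (ht : 0 < t) (r p q : ℕ) :
    rayDist (eisensteinDir t) (r * (p ^ 2 + 2 * p * q), r * (2 * p * q + 3 * q ^ 2)) =
      ENNReal.ofReal (Real.sqrt 3 * (r * formVal (3 * t) (straight t) p q)) := by
  have hd : 0 < 9 * t ^ 2 + 9 * t + 3 := by positivity
  rw [eisensteinDir, rayDist_eq (by positivity) (by positivity) (eisensteinDir_sq ht)]
  congr 1
  unfold formVal straight
  push_cast
  have e1 : (r * (p ^ 2 + 2 * p * q) : ℝ) * ((6 * t + 3) / (9 * t ^ 2 + 9 * t + 3))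
      - r * (2 * p * q + 3 * q ^ 2) * ((9 * t ^ 2 + 6 * t) / (9 * t ^ 2 + 9 * t + 3))
      = (p - 3 * t * q) * (r * ((6 * t + 3) * p + (9 * t + 6) * q) / (9 * t ^ 2 + 9 * t + 3)) := by
    field_simp
    ring
  have e2 : (3 * t * ((2 * t + 1) / (3 * t + 2)) + 1) = 2 * (9 * t ^ 2 + 9 * t + 3) / (3 * (3 * t + 2)) := by
    field_simp; ring
  have e3 : (2 * t + 1) / (3 * t + 2) * p + q = ((2 * t + 1) * p + (3 * t + 2) * q) / (3 * t + 2) := by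
    field_simp
  have hpos : 0 ≤ (r * ((6 * t + 3) * p + (9 * t + 6) * q) / (9 * t ^ 2 + 9 * t + 3) : ℝ) := by
    positivity
  rw [e1, e2, e3, abs_mul, abs_of_nonneg hpos]
  field_simp
  ring

lemma rayDist_left {t : ℝ} (ht : 0 < t) (r p q : ℕ) :
    rayDist (eisensteinDir t) (r * (3 * p ^ 2 + 2 * p * q), r * (2 * p * q + q ^ 2)) =
      ENNReal.ofReal (Real.sqrt 3 * (r * formVal t (3 * straight t) p q)) := by
  have hd : 0 < 9 * t ^ 2 + 9 * t + 3 := by positivity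
  rw [eisensteinDir, rayDist_eq (by positivity) (by positivity) (eisensteinDir_sq ht)]
  congr 1
  unfold formVal straight
  push_cast
  have e1 : (r * (3 * p ^ 2 + 2 * p * q) : ℝ) * ((6 * t + 3) / (9 * t ^ 2 + 9 * t + 3))
      - r * (2 * p * q + q ^ 2) * ((9 * t ^ 2 + 6 * t) / (9 * t ^ 2 + 9 * t + 3))
      = (p - t * q) * (r * ((18 * t + 9) * p + (9 * t + 6) * q) / (9 * t ^ 2 + 9 * t + 3)) := by
    field_simp
    ring
  have e2 : (t * (3 * ((2 * t + 1) / (3 * t + 2))) + 1)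
      = 2 * (9 * t ^ 2 + 9 * t + 3) / (3 * (3 * t + 2)) := by
    field_simp; ring
  have e3 : 3 * ((2 * t + 1) / (3 * t + 2)) * p + q
      = (3 * (2 * t + 1) * p + (3 * t + 2) * q) / (3 * t + 2) := by
    field_simp
  have hpos : 0 ≤ (r * ((18 * t + 9) * p + (9 * t + 6) * q) / (9 * t ^ 2 + 9 * t + 3) : ℝ) := by
    positivity
  rw [e1, e2, e3, abs_mul, abs_of_nonneg hpos]
  field_simp
  ring

lemma formVal_mul (τ ν : ℝ) (n p q : ℕ) :
    formVal τ ν (n * p) (n * q) = n ^ 2 * formVal τ ν p q := by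
  unfold formVal
  push_cast
  have e : (n * p - τ * (n * q) : ℝ) = n * (p - τ * q) := by ring
  rw [e, abs_mul, Nat.abs_cast]
  ring

lemma formVal_nonneg {τ ν : ℝ} (hτ : 0 ≤ τ) (hν : 0 ≤ ν) (p q : ℕ) : 0 ≤ formVal τ ν p q := by
  unfold formVal
  positivity

/-- A pair with small (p, q) but large multiplier r is handled by homogeneity: r ≥ K² dominates the
value at the large point (Kp, Kq). -/
lemma le_mul_formVal {τ ν c : ℝ} {K r p q : ℕ} (hr : 0 < r) (hτ : 0 ≤ τ) (hν : 0 ≤ ν)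
    (h : ∀ n : ℕ, K ≤ n * (p + q) → 0 < n → c ≤ formVal τ ν (n * p) (n * q)) (hpq : 0 < p + q)
    (hK : 0 < K) (hrK : K ≤ p + q ∨ K ^ 2 ≤ r) : c ≤ r * formVal τ ν p q := by
  have h0 := formVal_nonneg hτ hν p q
  rcases hrK with h1 | h1
  · have := h 1 (by omega) one_pos
    rw [one_mul, one_mul] at this
    exact this.trans (le_mul_of_one_le_left h0 (one_le_cast hr))
  · have := h K (Nat.le_mul_of_pos_right _ hpq) hK
    rw [formVal_mul] at this
    exact this.trans (mul_le_mul_of_nonneg_right (by exact_mod_cast h1) h0)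

lemma lagrValue_le_eisensteinDelta {t : ℝ} (ht : 0 < t) :
    lagrValue t ≤ eisensteinDelta (eisensteinDir t) := by
  refine lagrValue_le fun c c' h0 hc hp => ?_
  have hs := straight_pos ht
  obtain ⟨K, hK⟩ := hp.exists_goodFrom ht hs h0 hc
  refine le_liminf_of_le (by isBoundedDefault) ?_
  rw [eventually_comap_iff]
  have hK' : GoodFrom t (straight t) c' (K + 1) := hK.mono (Nat.le_succ K)
  -- Since a + b ≤ 6 r (p + q)², a pair this large has p + q ≥ K + 1 or r ≥ (K + 1)².
  refine ⟨(6 * (K + 1) ^ 4 : ℕ) + 1, ?_⟩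
  rintro ⟨⟨a, b⟩, hab⟩ hR
  dsimp only at hR ⊢
  have hn : 6 * (K + 1) ^ 4 + 1 ≤ a + b := by
    exact_mod_cast hR.trans (norm_eisensteinPoint_le (a, b))
  obtain ⟨r, p, q, hr, hp, hq, h⟩ := hab.exists_eq
  have hsize : a + b ≤ r * (6 * (p + q) ^ 2) → K + 1 ≤ p + q ∨ (K + 1) ^ 2 ≤ r := by
    intro hle
    by_contra hcon
    push Not at hcon
    have e1 : (p + q) ^ 2 ≤ (K + 1) ^ 2 := Nat.pow_le_pow_left hcon.1.le 2
    have e2 : r * (6 * (p + q) ^ 2) ≤ (K + 1) ^ 2 * (6 * (K + 1) ^ 2) :=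
      Nat.mul_le_mul hcon.2.le (Nat.mul_le_mul_left 6 e1)
    have e3 : (K + 1) ^ 2 * (6 * (K + 1) ^ 2) = 6 * (K + 1) ^ 4 := by ring
    omega
  rcases h with h | h <;> rw [h]
  · obtain ⟨rfl, rfl⟩ := Prod.mk.inj h
    rw [rayDist_left ht]
    refine ENNReal.ofReal_le_ofReal (mul_le_mul_of_nonneg_left ?_ sqrt_three_pos.le)
    refine le_mul_formVal (K := K + 1) hr ht.le (by positivity) (fun n h1 h2 => ?_) (by omega)
      (by omega) (hsize ?_)
    · exact (hK' _ _ (by rw [← mul_add]; positivity) (by rwa [← mul_add])).1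
    · rw [← mul_add]
      exact Nat.mul_le_mul_left r (by nlinarith)
  · obtain ⟨rfl, rfl⟩ := Prod.mk.inj h
    rw [rayDist_right ht]
    refine ENNReal.ofReal_le_ofReal (mul_le_mul_of_nonneg_left ?_ sqrt_three_pos.le)
    refine le_mul_formVal (K := K + 1) hr (by positivity) hs.le (fun n h1 h2 => ?_) (by omega)
      (by omega) (hsize ?_)
    · exact (hK' _ _ (by rw [← mul_add]; positivity) (by rwa [← mul_add])).2
    · rw [← mul_add]
      exact Nat.mul_le_mul_left r (by nlinarith)

/-- Here the pairs with multiplier r = 1 suffice: their distances are √3 times the form values at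
all positive (p, q), on each of the two lattices. -/
lemma eisensteinDelta_le_lagrValue {t : ℝ} (ht : 0 < t) :
    eisensteinDelta (eisensteinDir t) ≤ lagrValue t := by
  refine le_of_forall_lt fun x hx => ?_
  by_contra hX
  push Not at hX
  obtain ⟨y, hxy, hy⟩ := exists_between hx
  have hyt : y ≠ ⊤ := (hy.trans_le le_top).ne
  have h3 := sqrt_three_pos
  have hs := straight_pos ht
  have hev := eventually_lt_of_lt_liminf hy (by isBoundedDefault)
  rw [eventually_comap_iff] at hev
  obtain ⟨R, hR⟩ := hev
  obtain ⟨N, hN⟩ := exists_nat_ge R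
  have ey : y = ENNReal.ofReal (Real.sqrt 3 * (y.toReal / Real.sqrt 3)) := by
    rw [mul_div_cancel₀ _ h3.ne', ENNReal.ofReal_toReal hyt]
  have conv : ∀ {f : ℝ}, 0 ≤ f → y < ENNReal.ofReal (Real.sqrt 3 * ((1 : ℕ) * f)) →
      y.toReal / Real.sqrt 3 ≤ f := by
    intro f hf h
    rw [Nat.cast_one, one_mul] at h
    have := (ENNReal.lt_ofReal_iff_toReal_lt hyt).1 h
    rw [div_le_iff₀ h3]
    linarith
  refine absurd (lt_of_lt_of_le hxy ?_) (not_lt.2 hX)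
  rw [ey]
  refine ofReal_sqrt_mul_le_of_forall fun c' h0 hc => ofReal_le_lagrValue ⟨?_, ?_⟩
  · refine lagr_of_le_formVal (ν := 3 * straight t) ht (by positivity) h0 hc
      ⟨N + 1, fun p q hp hq => ?_⟩
    apply conv (formVal_nonneg ht.le (by positivity) p q)
    rw [← rayDist_left ht]
    have h := isEisensteinPair_left hp (by omega : 0 < q)
    have := hR ⟨_, h⟩ (by
      refine hN.trans (le_trans ?_ (le_norm_eisensteinPoint _))
      dsimp only
      have : N ≤ 2 * p * q + q ^ 2 := by nlinarith
      exact_mod_cast this)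
    rwa [one_mul, one_mul]
  · refine lagr_of_le_formVal (ν := straight t) (by positivity) hs h0 hc
      ⟨N + 1, fun p q hp hq => ?_⟩
    apply conv (formVal_nonneg (by positivity) hs.le p q)
    rw [← rayDist_right ht]
    have h := isEisensteinPair_right hp (by omega : 0 < q)
    have := hR ⟨_, h⟩ (by
      refine hN.trans (le_trans ?_ (le_norm_eisensteinPoint _))
      dsimp only
      have : N ≤ 2 * p * q + 3 * q ^ 2 := by nlinarith
      exact_mod_cast this)
    rwa [one_mul, one_mul]

lemma eisensteinDelta_eisensteinDir {t : ℝ} (ht : 0 < t) :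
    eisensteinDelta (eisensteinDir t) = lagrValue t :=
  le_antisymm (eisensteinDelta_le_lagrValue ht) (lagrValue_le_eisensteinDelta ht)

lemma exists_eisensteinDelta_eq {z : ℂ} (hz : ‖z‖ = 1) (h : eisensteinDelta z < ⊤) :
    ∃ t, 0 < t ∧ eisensteinDelta z = lagrValue t := by
  obtain ⟨α, β, rfl⟩ := exists_eq_eisensteinCoord z
  rw [norm_eisensteinCoord, Real.sqrt_eq_one] at hz
  by_cases hneg : α ≤ 0 ∨ β ≤ 0
  · exact absurd (eisensteinDelta_eq_top hneg) h.ne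
  · push Not at hneg
    obtain ⟨t, ht, e⟩ := exists_eq_eisensteinDir hneg.1 hneg.2 hz
    exact ⟨t, ht, by rw [e, eisensteinDelta_eisensteinDir ht]⟩

lemma toReal_lagrValue_fixed {k : ℕ} (hk : 1 ≤ k) {w : ℝ} (hw : 0 < w)
    (hfix : theta^[k] (straight w) = w) :
    (lagrValue w).toReal = Real.sqrt 3 * (1 / turnHeight w) := by
  have := straight_pos hw
  rw [lagrValue_fixed hk hw hfix, ENNReal.toReal_ofReal]
  unfold turnHeight
  positivity

/-! ### Conclusion -/

/-- `√3 / 4` is the greatest accumulation point of `{δ(z) : |z| = 1, δ(z) < ∞}`. -/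
theorem theorem1p2 :
    IsGreatest {x : ℝ | AccPt x (𝓟 eisensteinDeltaSet)} (Real.sqrt 3 / 4) := by
  choose w hw hfix using fun k : ℕ => exists_theta_iterate_straight_eq (k := k + 1) (by omega)
  have hlim := tendsto_fixed hw hfix
  have h3 := sqrt_three_pos
  constructor
  · rw [Set.mem_ofPred_eq, accPt_iff_nhds]
    intro U hU
    obtain ⟨N, hN⟩ := eventually_atTop.1 (hlim.eventually hU)
    -- The index 2N + 1 belongs to the even block length 2N + 2, for which the value differs from
    -- √3/4.
    have hk : 1 ≤ 2 * N + 1 + 1 := by omega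
    have hw0 := hw (2 * N + 1)
    have hf := hfix (2 * N + 1)
    refine ⟨_, ⟨hN (2 * N + 1) (by omega), eisensteinDir (w (2 * N + 1)), norm_eisensteinDir hw0,
      ?_, ?_⟩, ?_⟩
    · rw [eisensteinDelta_eisensteinDir hw0, lagrValue_fixed hk hw0 hf]
      exact ENNReal.ofReal_lt_top
    · rw [eisensteinDelta_eisensteinDir hw0, toReal_lagrValue_fixed hk hw0 hf]
    · have h4 := turnHeight_lt_four hk ⟨N + 1, by ring⟩ hw0 hf
      have hs := straight_pos hw0
      have h0 : 0 < turnHeight (w (2 * N + 1)) := by unfold turnHeight; positivity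
      rw [mul_one_div]
      exact (div_lt_div_of_pos_left h3 h0 h4).ne'
  · intro x hx
    by_contra hlt
    push Not at hlt
    obtain ⟨m, hm1, hm2⟩ := exists_between hlt
    obtain ⟨N, hN⟩ := eventually_atTop.1 (hlim.eventually (gt_mem_nhds hm1))
    -- The spectrum above m > √3/4 lies in this finite set: two exceptional values, and the periodic
    -- ones before the sequence drops below m.
    set F : Finset ℝ := {(lagrValue thetaFix).toReal, (lagrValue (1 / Real.sqrt 3)).toReal} ∪
      (Finset.range N).image fun k => Real.sqrt 3 * (1 / turnHeight (w k)) with hF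
    have hsub : ∀ y ∈ eisensteinDeltaSet, m < y → y ∈ F := by
      rintro y ⟨z, hz, hfin, rfl⟩ hy
      obtain ⟨t, ht, e⟩ := exists_eisensteinDelta_eq hz hfin
      rw [e] at hy hfin ⊢
      have hgt : ENNReal.ofReal (Real.sqrt 3 / 4) < lagrValue t :=
        (ENNReal.ofReal_lt_iff_lt_toReal (by positivity) hfin.ne).2 (hm1.trans hy)
      rcases isClassified_lagrValue ht hgt with h | h | ⟨k, u, hk, -, hu, hf, h⟩
      · rw [h]; simp [hF]
      · rw [h]; simp [hF]
      · obtain ⟨j, rfl⟩ : ∃ j, k = j + 1 := ⟨k - 1, by omega⟩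
        obtain rfl := fixed_unique hu (hw j) hf (hfix j)
        rw [h, toReal_lagrValue_fixed hk hu hf] at hy ⊢
        have hj : j < N := by
          by_contra hcon
          exact absurd (hN j (not_lt.1 hcon)) (not_lt.2 hy.le)
        exact Finset.mem_union_right _ (Finset.mem_image_of_mem _ (Finset.mem_range.2 hj))
    have hU : Set.Ioi m ∩ ((F.erase x : Finset ℝ) : Set ℝ)ᶜ ∈ 𝓝 x :=
      inter_mem (Ioi_mem_nhds hm2)
        ((F.erase x).finite_toSet.isClosed.isOpen_compl.mem_nhds (by simp))
    obtain ⟨y, ⟨⟨hy1, hy2⟩, hy3⟩, hne⟩ := (accPt_iff_nhds.1 hx) _ hU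
    exact hy2 (by simpa [hne] using hsub y hy3 hy1)
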